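/- Let $T$ be a tiling of $\mathbb{R}^d$: a locally finite set of (possibly labelled) tiles, each a nonempty compact set that is the closure of its interior, which cover $\mathbb{R}^d$ and have pairwise disjoint interiors. For a tiling $S$, let $[B_t(x)]_S$ be the patch of all tiles of $S$ that meet the open ball $B_t(x)$. Let $\Omega$ be the tiling space of $T$, the closure of the set of translates of $T$ in the topology in which two tilings are close if, after a small translation, they agree on a large ball around the origin. For $t\in\mathbb{R}$ the approximant $K_t$ is the quotient space of $\Omega\times\mathbb{R}^d$ by the relation $(S,x)\sim_t(S',y)$ if and only if $[B_t(x)]_S-x=[B_t(y)]_{S'}-y$; let $\pi_t:\mathbb{R}^d\to K_t$, $x\mapsto[(T,x)]$, and for $s\le t$ let $f:K_t\to K_s$ be the forgetful map. Let $G$ be a topological group (for instance any group with the discrete topology) and fix $x_0\in\mathbb{R}^d$. An open set $U\subseteq\mathbb{R}^d$ is PE with radius $t>0$ if $x\in U$ and $[B_t(x)]_T-x=[B_t(y)]_T-y$ imply $y\in U$; a function on $U$ is PE with radius $t$ if it takes equal values at any two points of $U$ with $[B_t(x)]_T-x=[B_t(y)]_T-y$. A flat PE principal $G$-bundle with radius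 $t$ is a principal $G$-bundle $P\to\mathbb{R}^d$ with an atlas of local trivializations over a cover by PE open sets with radius $t$ whose transition functions are locally constant and PE with radius $t$. It is based if a point $p_0$ of the fiber over $x_0$ is chosen and the atlas has a chart around $x_0$ in which $p_0$ has the coordinate $1\in G$ and from which all transition functions to other charts equal $1$. Two such based bundles, of radii $p$ and $r$, are equivalent if for some $s\ge p,r$ there is a homeomorphism between them over $\mathbb{R}^d$ that preserves the base points and is given in the charts by left multiplication with locally constant functions that are PE with radius $s$. Let $PREP_b(T)$ be the set of equivalence classes. Let $t_1\le t_2\le\cdots$ be real numbers with $t_n\to\infty$. Then there is a bijection $$PREP_b(T)\;\cong\;\varinjlim_{f^*}\mathrm{Hom}\bigl(\pi_1(K_{t_n},\pi_{t_n}(x_0)),G\bigr),$$ where the limit is the direct limit of sets along the maps $f^*$ induced by the forgetful maps, with no quotient by conjugation. It is given by holonomy: a bundle $P$ whose radius is at most $t_n$ has a unique holonomy homomorphism $\rho:\pi_1(K_{t_n},\pi_{t_n}(x_0))\to G$ (the product of the transition functions along a loop, starting and ending in the chart around the base point), and the class of $P$ corresponds to the class of $\rho$. -/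

import Mathlib

open Set Filter Topology
open scoped Pointwise

universe u v

/-! ### Tilings of `ℝ^d` and their patches -/

/-- A tile of `ℝ^d`: a nonempty compact set that is the closure of its interior, with a label
(labels allow distinct tile types to have the same shape). -/
@[ext] structure Tile (d : ℕ) (L : Type v) where
  carrier : Set (EuclideanSpace ℝ (Fin d))
  label : L
  isCompact : IsCompact carrier
  nonempty : carrier.Nonempty
  closure_interior : closure (interior carrier) = carrier

namespace Tile

variable {d : ℕ} {L : Type v}

/-- The translate `A + v` of a tile. -/
def translate (v : EuclideanSpace ℝ (Fin d)) (A : Tile d L) : Tile d L where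
  carrier := v +ᵥ A.carrier
  label := A.label
  isCompact := A.isCompact.vadd v
  nonempty := A.nonempty.vadd_set
  closure_interior := by rw [interior_vadd, closure_vadd, A.closure_interior]

theorem translate_translate (v w : EuclideanSpace ℝ (Fin d)) (A : Tile d L) :
    (A.translate v).translate w = A.translate (w + v) := by
  ext1
  · simp [translate, vadd_vadd]
  · rfl

theorem translate_zero (A : Tile d L) : A.translate 0 = A := by
  ext1
  · simp [translate]
  · rfl

theorem translate_injective (v : EuclideanSpace ℝ (Fin d)) :
    Function.Injective (translate v : Tile d L → Tile d L) := by
  intro A B h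
  have := congrArg (translate (-v)) h
  simpa [translate_translate, translate_zero] using this

end Tile

/-- A tiling of `ℝ^d`: a locally finite set of tiles which cover `ℝ^d` and have pairwise disjoint
interiors. -/
@[ext] structure Tiling (d : ℕ) (L : Type v) where
  tiles : Set (Tile d L)
  cover : ∀ x, ∃ A ∈ tiles, x ∈ A.carrier
  disjoint : ∀ A ∈ tiles, ∀ B ∈ tiles, A ≠ B → Disjoint (interior A.carrier) (interior B.carrier)
  locallyFinite : ∀ x r, {A ∈ tiles | (A.carrier ∩ Metric.ball x r).Nonempty}.Finite

namespace Tiling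

variable {d : ℕ} {L : Type v}

/-- The patch `[B_t(x)]` of the tiling `T`: the set of the tiles of `T` that meet the open ball
`B_t(x)`. It is the smallest set of tiles of `T` whose union contains that ball. -/
def patch (T : Tiling d L) (t : ℝ) (x : EuclideanSpace ℝ (Fin d)) : Set (Tile d L) :=
  {A ∈ T.tiles | (A.carrier ∩ Metric.ball x t).Nonempty}

/-- `[B_t(x)] - x`, the patch of radius `t` at `x` moved to the origin. -/
def centeredPatch (T : Tiling d L) (t : ℝ) (x : EuclideanSpace ℝ (Fin d)) : Set (Tile d L) :=
  Tile.translate (-x) '' T.patch t x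

theorem meets_translate (v x : EuclideanSpace ℝ (Fin d)) (t : ℝ) (A : Tile d L) :
    ((A.translate v).carrier ∩ Metric.ball x t).Nonempty ↔
      (A.carrier ∩ Metric.ball (x - v) t).Nonempty := by
  constructor
  · rintro ⟨_, ⟨z, hz, rfl⟩, hb⟩
    refine ⟨z, hz, ?_⟩
    simp only [vadd_eq_add, Metric.mem_ball, dist_eq_norm] at hb ⊢
    rwa [show z - (x - v) = v + z - x by abel]
  · rintro ⟨z, hz, hb⟩
    refine ⟨v + z, ⟨z, hz, rfl⟩, ?_⟩
    simp only [Metric.mem_ball, dist_eq_norm] at hb ⊢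
    rwa [show v + z - x = z - (x - v) by abel]

/-- The translate `T + v` of a tiling. -/
def translate (T : Tiling d L) (v : EuclideanSpace ℝ (Fin d)) : Tiling d L where
  tiles := Tile.translate v '' T.tiles
  cover x := by
    obtain ⟨A, hA, hx⟩ := T.cover (x - v)
    exact ⟨_, ⟨A, hA, rfl⟩, x - v, hx, by simp⟩
  disjoint := by
    rintro _ ⟨A, hA, rfl⟩ _ ⟨B, hB, rfl⟩ hne
    have h := T.disjoint A hA B hB (fun h => hne (by rw [h]))
    simp only [Tile.translate, interior_vadd]
    rw [Set.disjoint_left] at h ⊢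
    rintro _ ⟨a, ha, rfl⟩ ⟨b, hb, hab⟩
    have hba : b = a := by simpa using hab
    exact h ha (hba ▸ hb)
  locallyFinite x r := by
    refine ((T.locallyFinite (x - v) r).image (Tile.translate v)).subset ?_
    rintro _ ⟨⟨A, hA, rfl⟩, h⟩
    exact ⟨A, ⟨hA, (meets_translate v x r A).1 h⟩, rfl⟩

theorem patch_eq_of_le {T S : Tiling d L} {s t : ℝ} (hst : s ≤ t)
    {x : EuclideanSpace ℝ (Fin d)} (h : T.patch t x = S.patch t x) : T.patch s x = S.patch s x := by
  have key : ∀ R : Tiling d L,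
      R.patch s x = {A ∈ R.patch t x | (A.carrier ∩ Metric.ball x s).Nonempty} := by
    intro R
    ext A
    exact ⟨fun hA => ⟨⟨hA.1, hA.2.mono (inter_subset_inter_right _ (Metric.ball_subset_ball hst))⟩,
      hA.2⟩, fun hA => ⟨hA.1.1, hA.2⟩⟩
  rw [key T, key S, h]

theorem centeredPatch_eq_of_le {T S : Tiling d L} {s t : ℝ} (hst : s ≤ t)
    {x y : EuclideanSpace ℝ (Fin d)} (h : T.centeredPatch t x = S.centeredPatch t y) :
    T.centeredPatch s x = S.centeredPatch s y := by
  have key : ∀ (R : Tiling d L) (z : EuclideanSpace ℝ (Fin d)), R.centeredPatch s z =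
      {A ∈ R.centeredPatch t z | (A.carrier ∩ Metric.ball 0 s).Nonempty} := by
    intro R z
    ext A
    constructor
    · rintro ⟨B, hB, rfl⟩
      exact ⟨⟨B, ⟨hB.1, hB.2.mono (inter_subset_inter_right _ (Metric.ball_subset_ball hst))⟩, rfl⟩,
        (meets_translate _ _ _ _).2 (by simpa using hB.2)⟩
    · rintro ⟨⟨B, hB, rfl⟩, hA⟩
      exact ⟨B, ⟨hB.1, by simpa using (meets_translate _ _ _ _).1 hA⟩, rfl⟩
  rw [key T, key S, h]

/-- The tiling topology: `S` is close to `T` if a translate of `S` by a small vector agrees with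
`T` on a large ball around the origin. -/
instance : TopologicalSpace (Tiling d L) where
  IsOpen U := ∀ T ∈ U, ∃ r : ℝ, ∃ ε > (0 : ℝ), ∀ S : Tiling d L,
    (∃ v, ‖v‖ < ε ∧ (S.translate v).patch r 0 = T.patch r 0) → S ∈ U
  isOpen_univ := fun _ _ => ⟨0, 1, one_pos, fun _ _ => mem_univ _⟩
  isOpen_inter := by
    rintro U V hU hV T ⟨hTU, hTV⟩
    obtain ⟨r, ε, hε, h⟩ := hU T hTU
    obtain ⟨r', ε', hε', h'⟩ := hV T hTV
    refine ⟨max r r', min ε ε', lt_min hε hε', ?_⟩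
    rintro S ⟨v, hv, hS⟩
    exact ⟨h S ⟨v, hv.trans_le (min_le_left _ _), patch_eq_of_le (le_max_left _ _) hS⟩,
      h' S ⟨v, hv.trans_le (min_le_right _ _), patch_eq_of_le (le_max_right _ _) hS⟩⟩
  isOpen_sUnion := by
    rintro 𝒰 h𝒰 T ⟨U, hU, hT⟩
    obtain ⟨r, ε, hε, h⟩ := h𝒰 U hU T hT
    exact ⟨r, ε, hε, fun S hS => ⟨U, hU, h S hS⟩⟩

/-- The tiling space `Ω` of `T`: the closure of the set of all translates of `T`. -/
def hull (T : Tiling d L) : Set (Tiling d L) :=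
  closure (Set.range fun v => T.translate v)

theorem translate_zero (T : Tiling d L) : T.translate 0 = T := by
  ext A
  simp [translate, Tile.translate_zero]

theorem mem_hull (T : Tiling d L) : T ∈ T.hull :=
  subset_closure ⟨0, T.translate_zero⟩

end Tiling

/-! ### The approximants -/

section Approximants

variable {d : ℕ} {L : Type v}

/-- The total space of the tautological `ℝ^d`-bundle over the tiling space of `T`: its points are
the pairs `(S, x)` of a tiling `S` in the tiling space and a point `x` of `S`. -/
abbrev TautBundle (T : Tiling d L) : Type v := T.hull × EuclideanSpace ℝ (Fin d)

/-- `(S, x)` and `(S', y)` are equivalent if `[B_t(x)] - x` in `S` equals `[B_t(y)] - y` in `S'`. -/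
def approximantSetoid (T : Tiling d L) (t : ℝ) : Setoid (TautBundle T) where
  r p q := p.1.1.centeredPatch t p.2 = q.1.1.centeredPatch t q.2
  iseqv := ⟨fun _ => rfl, fun h => h.symm, fun h h' => h.trans h'⟩

/-- The approximant `K_t` of the tiling space of `T`, with the quotient topology. -/
def Approximant (T : Tiling d L) (t : ℝ) : Type v := Quotient (approximantSetoid T t)

instance (T : Tiling d L) (t : ℝ) : TopologicalSpace (Approximant T t) :=
  inferInstanceAs (TopologicalSpace (Quotient (approximantSetoid T t)))

/-- The natural projection `π_t : ℝ^d → K_t`, which sends `x` to the class of `(T, x)`. -/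
def approximantProj (T : Tiling d L) (t : ℝ) (x : EuclideanSpace ℝ (Fin d)) : Approximant T t :=
  Quotient.mk (approximantSetoid T t) (⟨T, T.mem_hull⟩, x)

/-- The forgetful map `K_t → K_s` for `s ≤ t`. -/
def forgetful (T : Tiling d L) {s t : ℝ} (hst : s ≤ t) : C(Approximant T t, Approximant T s) where
  toFun := Quotient.map' (s₁ := approximantSetoid T t) (s₂ := approximantSetoid T s) id
    (fun _ _ h => Tiling.centeredPatch_eq_of_le hst h)
  continuous_toFun := continuous_id.quotient_map' _

theorem forgetful_proj (T : Tiling d L) {s t : ℝ} (hst : s ≤ t) (x : EuclideanSpace ℝ (Fin d)) :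
    forgetful T hst (approximantProj T t x) = approximantProj T s x := rfl

theorem forgetful_forgetful (T : Tiling d L) {r s t : ℝ} (hrs : r ≤ s) (hst : s ≤ t)
    (a : Approximant T t) :
    forgetful T hrs (forgetful T hst a) = forgetful T (hrs.trans hst) a := by
  induction a using Quotient.inductionOn
  rfl

/-- `π₁(K_t)` with base point the class of `(T, x₀)`. -/
abbrev approximantPi1 (T : Tiling d L) (x₀ : EuclideanSpace ℝ (Fin d)) (t : ℝ) : Type v :=
  FundamentalGroup (Approximant T t) (approximantProj T t x₀)

/-- The homomorphism `f_* : π₁(K_t) → π₁(K_s)` induced by the forgetful map. -/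
noncomputable def forgetfulPi1 (T : Tiling d L) (x₀ : EuclideanSpace ℝ (Fin d)) {s t : ℝ}
    (hst : s ≤ t) : approximantPi1 T x₀ t →* approximantPi1 T x₀ s :=
  FundamentalGroup.mapOfEq (forgetful T hst) (forgetful_proj T hst x₀)

/-- The map `f^* : Hom(π₁(K_s), G) → Hom(π₁(K_t), G)`, composition with `f_*`. -/
noncomputable def forgetfulDual (T : Tiling d L) (x₀ : EuclideanSpace ℝ (Fin d))
    (G : Type u) [Group G] {s t : ℝ} (hst : s ≤ t) (ρ : approximantPi1 T x₀ s →* G) :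
    approximantPi1 T x₀ t →* G :=
  ρ.comp (forgetfulPi1 T x₀ hst)

theorem forgetfulPi1_comp (T : Tiling d L) (x₀ : EuclideanSpace ℝ (Fin d))
    {r s t : ℝ} (hrs : r ≤ s) (hst : s ≤ t) (p : approximantPi1 T x₀ t) :
    forgetfulPi1 T x₀ hrs (forgetfulPi1 T x₀ hst p) = forgetfulPi1 T x₀ (hrs.trans hst) p := by
  unfold forgetfulPi1
  rw [FundamentalGroup.mapOfEq_apply, FundamentalGroup.mapOfEq_apply,
    FundamentalGroup.mapOfEq_apply]
  induction p using Quotient.inductionOn with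
  | _ γ =>
    apply congrArg (Quotient.mk (Path.Homotopic.setoid _ _))
    ext u
    exact forgetful_forgetful T hrs hst (γ u)

theorem forgetfulDual_comp (T : Tiling d L) (x₀ : EuclideanSpace ℝ (Fin d)) (G : Type u) [Group G]
    {r s t : ℝ} (hrs : r ≤ s) (hst : s ≤ t) (ρ : approximantPi1 T x₀ r →* G) :
    forgetfulDual T x₀ G hst (forgetfulDual T x₀ G hrs ρ) =
      forgetfulDual T x₀ G (hrs.trans hst) ρ :=
  MonoidHom.ext fun p => congrArg ρ (forgetfulPi1_comp T x₀ hrs hst p)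

/-- Two elements of the disjoint union of the sets `Hom(π₁(K_{t_n}), G)` are identified if some
`f^*` map them to the same element. -/
def homLimitSetoid (T : Tiling d L) (x₀ : EuclideanSpace ℝ (Fin d)) (G : Type u) [Group G]
    (t : ℕ → ℝ) (ht : Monotone t) : Setoid (Σ n, approximantPi1 T x₀ (t n) →* G) where
  r a b := ∃ k, ∃ (ha : a.1 ≤ k) (hb : b.1 ≤ k),
    forgetfulDual T x₀ G (ht ha) a.2 = forgetfulDual T x₀ G (ht hb) b.2
  iseqv := by
    refine ⟨fun a => ⟨a.1, le_rfl, le_rfl, rfl⟩, fun ⟨k, ha, hb, h⟩ => ⟨k, hb, ha, h.symm⟩, ?_⟩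
    rintro a b c ⟨k, ha, hb, h⟩ ⟨l, hb', hc, h'⟩
    refine ⟨max k l, ha.trans (le_max_left _ _), hc.trans (le_max_right _ _), ?_⟩
    have e := congrArg (forgetfulDual T x₀ G (ht (le_max_left k l))) h
    have e' := congrArg (forgetfulDual T x₀ G (ht (le_max_right k l))) h'
    simp only [forgetfulDual_comp] at e e'
    exact e.trans e'

/-- The direct limit of the sets `Hom(π₁(K_{t_n}), G)` along the maps `f^*`. -/
def HomLimit (T : Tiling d L) (x₀ : EuclideanSpace ℝ (Fin d)) (G : Type u) [Group G]
    (t : ℕ → ℝ) (ht : Monotone t) : Type (max u v) :=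
  Quotient (homLimitSetoid T x₀ G t ht)

/-- The canonical map `Hom(π₁(K_{t_n}), G) → lim Hom(π₁(K_{t_n}), G)`. -/
def HomLimit.of (T : Tiling d L) (x₀ : EuclideanSpace ℝ (Fin d)) (G : Type u) [Group G]
    (t : ℕ → ℝ) (ht : Monotone t) (n : ℕ) (ρ : approximantPi1 T x₀ (t n) →* G) :
    HomLimit T x₀ G t ht :=
  Quotient.mk (homLimitSetoid T x₀ G t ht) ⟨n, ρ⟩

end Approximants

/-! ### Pattern equivariant bundles -/

section PE

variable {d : ℕ} {L : Type v}

/-- A PE open set with radius `t`: an open set which, with every `x`, contains all `y` such that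
`[B_t(x)] - x = [B_t(y)] - y`. -/
def IsPEOpen (T : Tiling d L) (t : ℝ) (U : Set (EuclideanSpace ℝ (Fin d))) : Prop :=
  IsOpen U ∧ ∀ x ∈ U, ∀ y, T.centeredPatch t x = T.centeredPatch t y → y ∈ U

/-- A function on `U` is PE with radius `t` if it takes equal values at any two points of `U` with
equal centered patches of radius `t`. -/
def IsPEOn (T : Tiling d L) {α : Type*} (t : ℝ) (U : Set (EuclideanSpace ℝ (Fin d)))
    (f : EuclideanSpace ℝ (Fin d) → α) : Prop :=
  ∀ x ∈ U, ∀ y ∈ U, T.centeredPatch t x = T.centeredPatch t y → f x = f y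

/-- `f` is locally constant on the set `U`. -/
def IsLocallyConstantOn {α : Type*} (U : Set (EuclideanSpace ℝ (Fin d)))
    (f : EuclideanSpace ℝ (Fin d) → α) : Prop :=
  IsLocallyConstant (U.domRestrict f)

/-- A PE principal bundle over `T` with group `G` and a radius `t > 0`. The fiber is `G`, on which
`G` acts by left multiplication; `transition j i` is the transition function `h_{ji}` from the
chart `i` to the chart `j`, and only its values on `U_j ∩ U_i` matter. Since the transition
functions are left multiplications, right multiplication in the charts is a well-defined action of
`G` on the total space, which is free and transitive on each fiber. -/
structure PEPrincipalBundle (T : Tiling d L) (G : Type u) [Group G] [TopologicalSpace G] where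
  radius : ℝ
  radius_pos : 0 < radius
  Total : Type u
  [topTotal : TopologicalSpace Total]
  proj : Total → EuclideanSpace ℝ (Fin d)
  continuous_proj : Continuous proj
  surjective_proj : Function.Surjective proj
  /-- the index set of the charts -/
  Index : Type u
  U : Index → Set (EuclideanSpace ℝ (Fin d))
  isPEOpen_U : ∀ i, IsPEOpen T radius (U i)
  cover_U : ∀ x, ∃ i, x ∈ U i
  chart : ∀ i, (U i × G) ≃ₜ (proj ⁻¹' U i)
  proj_chart : ∀ i p, proj (chart i p) = p.1
  transition : Index → Index → EuclideanSpace ℝ (Fin d) → G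
  chart_eq : ∀ i j x (hi : x ∈ U i) (hj : x ∈ U j) (g : G),
    (chart i (⟨x, hi⟩, g) : Total) = chart j (⟨x, hj⟩, transition j i x * g)
  isPEOn_transition : ∀ i j, IsPEOn T radius (U j ∩ U i) (transition j i)

attribute [instance] PEPrincipalBundle.topTotal

/-- A flat based PE principal bundle with base point over `x₀`: the transition functions are
locally constant, a point `p₀` of the fiber over `x₀` is chosen, and there is a chart `U_{p₀}`
around `x₀` in which `p₀` has the coordinate `1` and such that all transition functions from this
chart to the other charts are equal to `1`. -/
structure FlatBasedPEBundle (T : Tiling d L) (G : Type u) [Group G] [TopologicalSpace G]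
    (x₀ : EuclideanSpace ℝ (Fin d)) extends PEPrincipalBundle T G where
  flat : ∀ i j, IsLocallyConstantOn (U j ∩ U i) (transition j i)
  basePoint : Total
  baseIndex : Index
  base_mem : x₀ ∈ U baseIndex
  chart_base : (chart baseIndex (⟨x₀, base_mem⟩, 1) : Total) = basePoint
  transition_base : ∀ j, ∀ x ∈ U j ∩ U baseIndex, transition j baseIndex x = 1

namespace FlatBasedPEBundle

variable {T : Tiling d L} {G : Type u} [Group G] [TopologicalSpace G]
  {x₀ : EuclideanSpace ℝ (Fin d)}

/-- `P` and `Q` are isomorphic as flat based PE bundles of radius `s`: there is a homeomorphism of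
the total spaces over the identity of `ℝ^d`, preserving the base points, that in any charts `i` of
`P` and `j` of `Q` is given by left multiplication with a locally constant function which is PE with
radius `s`. -/
def IsoAt (P Q : FlatBasedPEBundle T G x₀) (s : ℝ) : Prop :=
  ∃ e : P.Total ≃ₜ Q.Total, (∀ p, Q.proj (e p) = P.proj p) ∧ e P.basePoint = Q.basePoint ∧
    ∀ i j, ∃ l : EuclideanSpace ℝ (Fin d) → G,
      IsPEOn T s (P.U i ∩ Q.U j) l ∧ IsLocallyConstantOn (P.U i ∩ Q.U j) l ∧
      ∀ x (hi : x ∈ P.U i) (hj : x ∈ Q.U j) (g : G),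
        e (P.chart i (⟨x, hi⟩, g)) = Q.chart j (⟨x, hj⟩, l x * g)

/-- Two bundles are equivalent if they are isomorphic as bundles of radius `s` for some `s` that is
at least both radii. -/
def Equivalent (P Q : FlatBasedPEBundle T G x₀) : Prop :=
  ∃ s, P.radius ≤ s ∧ Q.radius ≤ s ∧ P.IsoAt Q s

theorem _root_.IsPEOn.mono {α : Type*} {s t : ℝ} (hst : s ≤ t)
    {U : Set (EuclideanSpace ℝ (Fin d))} {f : EuclideanSpace ℝ (Fin d) → α}
    (h : IsPEOn T s U f) : IsPEOn T t U f :=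
  fun x hx y hy hxy => h x hx y hy (Tiling.centeredPatch_eq_of_le hst hxy)

theorem isLocallyConstantOn_iff {α : Type*} {U : Set (EuclideanSpace ℝ (Fin d))}
    {f : EuclideanSpace ℝ (Fin d) → α} :
    IsLocallyConstantOn U f ↔ ∀ x ∈ U, ∀ᶠ y in 𝓝[U] x, f y = f x := by
  rw [IsLocallyConstantOn, IsLocallyConstant.iff_eventually_eq]
  constructor
  · intro h x hx
    rw [nhdsWithin_eq_map_subtype_coe hx]
    exact h ⟨x, hx⟩
  · rintro h ⟨x, hx⟩
    have := h x hx
    rw [nhdsWithin_eq_map_subtype_coe hx] at this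
    exact this

theorem chart_inj (P : FlatBasedPEBundle T G x₀) {i : P.Index} {x : EuclideanSpace ℝ (Fin d)}
    {hi : x ∈ P.U i} {g g' : G}
    (h : (P.chart i (⟨x, hi⟩, g) : P.Total) = P.chart i (⟨x, hi⟩, g')) : g = g' := by
  have := (P.chart i).injective (Subtype.ext h)
  simpa using this

theorem Equivalent.refl (P : FlatBasedPEBundle T G x₀) : P.Equivalent P :=
  ⟨P.radius, le_rfl, le_rfl, Homeomorph.refl _, fun _ => rfl, rfl, fun i j =>
    ⟨P.transition j i, by rw [inter_comm]; exact P.isPEOn_transition i j,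
      by rw [inter_comm]; exact P.flat i j, fun x hi hj g => P.chart_eq i j x hi hj g⟩⟩

theorem Equivalent.symm {P Q : FlatBasedPEBundle T G x₀} (h : P.Equivalent Q) :
    Q.Equivalent P := by
  obtain ⟨s, hP, hQ, e, he, hb, hl⟩ := h
  refine ⟨s, hQ, hP, e.symm, fun p => ?_, ?_, fun j i => ?_⟩
  · rw [← he, e.apply_symm_apply]
  · rw [← hb, e.symm_apply_apply]
  · obtain ⟨l, h1, h2, h3⟩ := hl i j
    refine ⟨fun x => (l x)⁻¹, ?_, ?_, ?_⟩
    · intro x hx y hy hxy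
      exact congrArg _ (h1 x hx.symm y hy.symm hxy)
    · rw [inter_comm]
      rw [isLocallyConstantOn_iff] at *
      intro x hx
      filter_upwards [h2 x hx] with y hy
      rw [hy]
    · intro x hj hi g
      rw [e.symm_apply_eq, h3 x hi hj]
      simp

theorem Equivalent.trans {P Q R : FlatBasedPEBundle T G x₀} (h : P.Equivalent Q)
    (h' : Q.Equivalent R) : P.Equivalent R := by
  obtain ⟨s, hP, hQ, e, he, hb, hl⟩ := h
  obtain ⟨s', hQ', hR, e', he', hb', hl'⟩ := h'
  refine ⟨max s s', hP.trans (le_max_left _ _), hR.trans (le_max_right _ _), e.trans e',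
    fun p => by simp [he, he'], by simp [hb, hb'], fun i k => ?_⟩
  choose l h1 h2 h3 using hl
  choose l' h1' h2' h3' using hl'
  choose c hc using Q.cover_U
  -- the composite, computed through any chart `j` of `Q`
  have key : ∀ j x (hi : x ∈ P.U i) (_ : x ∈ Q.U j) (hk : x ∈ R.U k) (g : G),
      (e.trans e') (P.chart i (⟨x, hi⟩, g)) = R.chart k (⟨x, hk⟩, l' j k x * l i j x * g) := by
    intro j x hi hj hk g
    rw [Homeomorph.trans_apply, h3 i j x hi hj, h3' j k x hj hk, mul_assoc]
  have indep : ∀ j x, x ∈ P.U i ∩ R.U k → x ∈ Q.U j →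
      l' (c x) k x * l i (c x) x = l' j k x * l i j x := by
    intro j x hx hj
    have := (key (c x) x hx.1 (hc x) hx.2 1).symm.trans (key j x hx.1 hj hx.2 1)
    simpa using R.chart_inj this
  refine ⟨fun x => l' (c x) k x * l i (c x) x, ?_, ?_, ?_⟩
  · intro x hx y hy hxy
    have hyj : y ∈ Q.U (c x) := (Q.isPEOpen_U (c x)).2 x (hc x) y
      (Tiling.centeredPatch_eq_of_le (hQ.trans (le_max_left _ _)) hxy)
    change l' (c x) k x * l i (c x) x = l' (c y) k y * l i (c y) y
    rw [indep (c x) y hy hyj,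
      (h1 i (c x)).mono (le_max_left s s') x ⟨hx.1, hc x⟩ y ⟨hy.1, hyj⟩ hxy,
      (h1' (c x) k).mono (le_max_right s s') x ⟨hc x, hx.2⟩ y ⟨hyj, hy.2⟩ hxy]
  · rw [isLocallyConstantOn_iff]
    intro x hx
    have op : ∀ {A B : Set (EuclideanSpace ℝ (Fin d))}, IsOpen A → IsOpen B → x ∈ A ∩ B →
        𝓝[A ∩ B] x = 𝓝 x := fun hA hB h => (hA.inter hB).nhdsWithin_eq h
    have oP := (P.isPEOpen_U i).1
    have oQ := (Q.isPEOpen_U (c x)).1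
    have oR := (R.isPEOpen_U k).1
    have a := isLocallyConstantOn_iff.1 (h2 i (c x)) x ⟨hx.1, hc x⟩
    have b := isLocallyConstantOn_iff.1 (h2' (c x) k) x ⟨hc x, hx.2⟩
    rw [op oP oQ ⟨hx.1, hc x⟩] at a
    rw [op oQ oR ⟨hc x, hx.2⟩] at b
    rw [op oP oR hx]
    filter_upwards [a, b, (oP.inter oR).mem_nhds hx, oQ.mem_nhds (hc x)] with y ha hb hy hyj
    rw [indep (c x) y hy hyj, ha, hb]
  · intro x hi hk g
    exact key (c x) x hi (hc x) hk g

/-- The parallel transport through the charts `j 0, j 1, …, j m`, where one passes from the chart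
`j k` to the chart `j (k + 1)` at the point `y k`: the product of the transition functions. -/
def transport (P : FlatBasedPEBundle T G x₀) (j : ℕ → P.Index)
    (y : ℕ → EuclideanSpace ℝ (Fin d)) : ℕ → G
  | 0 => 1
  | m + 1 => P.transition (j (m + 1)) (j m) (y m) * P.transport j y m

/-- `ρ : π₁(K_t) → G` is the holonomy of the bundle `P`, regarded as a bundle on `K_t`. Let `γ` be a
loop in `K_t` at the base point, divided by `0 = s 0 ≤ s 1 ≤ … ≤ s (m + 1) = 1` into pieces that lie
in (the images in `K_t` of) the charts `j 0, …, j m`, where the first and the last chart are the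
chart around the base point. Then `ρ` maps the class of `γ` to the product of the transition
functions at the division points. (In `FundamentalGroup`, a product `a * b` stands for the loop `b`
followed by the loop `a`.) -/
def IsHolonomy (P : FlatBasedPEBundle T G x₀) (t : ℝ) (ρ : approximantPi1 T x₀ t →* G) : Prop :=
  ∀ (γ : Path (approximantProj T t x₀) (approximantProj T t x₀)) (m : ℕ)
    (s : ℕ → unitInterval) (j : ℕ → P.Index) (y : ℕ → EuclideanSpace ℝ (Fin d)),
    Monotone s → s 0 = 0 → s (m + 1) = 1 → j 0 = P.baseIndex → j m = P.baseIndex →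
    (∀ k ≤ m, ∀ a ∈ Icc (s k) (s (k + 1)), γ a ∈ approximantProj T t '' P.U (j k)) →
    (∀ k < m, approximantProj T t (y k) = γ (s (k + 1))) →
    ρ (FundamentalGroup.fromPath (Path.Homotopic.Quotient.mk γ)) = P.transport j y m

end FlatBasedPEBundle

/-- The equivalence relation on flat based PE principal bundles. -/
def flatBasedPEBundleSetoid (T : Tiling d L) (G : Type u) [Group G] [TopologicalSpace G]
    (x₀ : EuclideanSpace ℝ (Fin d)) : Setoid (FlatBasedPEBundle T G x₀) where
  r := FlatBasedPEBundle.Equivalent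
  iseqv := ⟨.refl, .symm, .trans⟩

/-- The based PE representation variety `PREP_b(T)`. -/
def PREPb (T : Tiling d L) (G : Type u) [Group G] [TopologicalSpace G]
    (x₀ : EuclideanSpace ℝ (Fin d)) : Type (u + 1) :=
  Quotient (flatBasedPEBundleSetoid T G x₀)

/-- The class of a bundle in `PREP_b(T)`. -/
def PREPb.mk {T : Tiling d L} {G : Type u} [Group G] [TopologicalSpace G]
    {x₀ : EuclideanSpace ℝ (Fin d)} (P : FlatBasedPEBundle T G x₀) : PREPb T G x₀ :=
  Quotient.mk (flatBasedPEBundleSetoid T G x₀) P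

end PE

/-! The proof is the holonomy correspondence for flat bundles, adapted to spaces `K_t` about which
only path connectedness is known.

From bundles to homomorphisms: PE sets and PE functions of radius at most `t` are constant on the
fibers of `ℝ^d → K_t`, and this map is a quotient map (`isQuotientMap_approximantProj`). So the
transition functions descend to a locally constant cocycle on `K_t`. The cocycle defines a covering
space with discrete fiber `G`, whose monodromy is the parallel transport
(`FlatCocycle.exists_pathRep`). Transport is kept on all paths, as a `PathRep`, together with
coordinates of reference points in the charts (`IsFrame`); multiplying these along a subdivided loop
gives the product of transition functions. An isomorphism carries frames to frames with the same
transport, so the holonomy depends only on the class.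

Injectivity: `ℝ^d` is simply connected, so transport along any path from `x₀` trivializes the pulled
back bundle. For two bundles the trivializations give an isomorphism over `ℝ^d`. It is PE because
the transports to two points over the same point of `K_t` differ by the holonomy of a loop, which is
the same for both bundles (`IsHolonomy.isoAt`).

Surjectivity: `K_s` need not be locally simply connected, so a homomorphism on `π₁(K_s)` need not
come from a bundle on `K_s`. But for `t ≥ max s 0 + 3` the forgetful map `K_t → K_s` lifts locally
to `ℝ^d` (`exists_localLifts`): a point near a copy of a large patch of `T` is moved to the
corresponding point near one fixed copy. On the domain of a lift the pulled back transport is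
trivial, which provides the charts of a bundle of radius `t`. The loss of radius disappears in the
direct limit. -/

/-! ### Representations of the fundamental groupoid in a group -/

/-- A representation of the fundamental groupoid of `K` in a group: a homotopy invariant and
multiplicative function on paths. The path travelled first acts first. -/
structure PathRep (K : Type*) [TopologicalSpace K] (G : Type*) [Group G] where
  hol : ∀ {z w : K}, Path z w → G
  hol_homotopic : ∀ {z w : K} {γ γ' : Path z w}, γ.Homotopic γ' → hol γ = hol γ'
  hol_trans : ∀ {z w y : K} (γ : Path z w) (γ' : Path w y), hol (γ.trans γ') = hol γ' * hol γ

namespace PathRep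

variable {K X G : Type*} [TopologicalSpace K] [TopologicalSpace X] [Group G]

theorem hol_congr (h : PathRep K G) {z w z' w' : K} {γ : Path z w} {γ' : Path z' w'}
    (e : ∀ a, γ a = γ' a) : h.hol γ = h.hol γ' := by
  obtain rfl : z = z' := by simpa using e 0
  obtain rfl : w = w' := by simpa using e 1
  congr 1
  ext a
  exact e a

theorem hol_refl (h : PathRep K G) (z : K) : h.hol (Path.refl z) = 1 := by
  have := h.hol_trans (Path.refl z) (Path.refl z)
  rw [Path.refl_trans_refl] at this
  simpa using this

theorem hol_subpath_trans (h : PathRep K G) {z w : K} (γ : Path z w) (a b c : unitInterval) :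
    h.hol (γ.subpath b c) * h.hol (γ.subpath a b) = h.hol (γ.subpath a c) := by
  rw [← h.hol_trans]
  exact h.hol_homotopic ⟨Path.Homotopy.subpathTransSubpath γ a b c⟩

theorem hol_subpath_self (h : PathRep K G) {z w : K} (γ : Path z w) (a : unitInterval) :
    h.hol (γ.subpath a a) = 1 := by
  rw [Path.subpath_self, hol_refl]

theorem hol_subpath_zero_one (h : PathRep K G) {z w : K} (γ : Path z w) :
    h.hol (γ.subpath 0 1) = h.hol γ := by
  rw [Path.subpath_zero_one]
  exact h.hol_congr fun _ => rfl

/-- The homomorphism on the fundamental group given by a path representation. -/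
def toHom (h : PathRep K G) (b : K) : FundamentalGroup K b →* G where
  toFun p := Quotient.liftOn p h.hol fun _ _ e => h.hol_homotopic e
  map_one' := h.hol_refl b
  map_mul' := by
    intro p q
    induction p using Quotient.inductionOn with
    | _ p =>
      induction q using Quotient.inductionOn with
      | _ q => exact h.hol_trans q p

theorem toHom_fromPath (h : PathRep K G) {b : K} (γ : Path b b) :
    h.toHom b (FundamentalGroup.fromPath (Path.Homotopic.Quotient.mk γ)) = h.hol γ := rfl

/-- The pullback of a path representation along a continuous map. -/
def comap (h : PathRep K G) (f : C(X, K)) : PathRep X G where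
  hol γ := h.hol (γ.map f.continuous)
  hol_homotopic e := h.hol_homotopic (e.map f)
  hol_trans γ γ' := by rw [Path.map_trans, h.hol_trans]

/-- The value of a path representation on the image of any path from `a` to `b` in a simply
connected space. -/
noncomputable def along [SimplyConnectedSpace X] (h : PathRep K G) (F : C(X, K)) (a b : X) : G :=
  h.hol ((PathConnectedSpace.somePath a b).map F.continuous)

theorem hol_map [SimplyConnectedSpace X] (h : PathRep K G) (F : C(X, K)) {a b : X}
    (p : Path a b) : h.hol (p.map F.continuous) = h.along F a b :=
  h.hol_homotopic ((SimplyConnectedSpace.paths_homotopic _ _).map F)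

theorem along_trans [SimplyConnectedSpace X] (h : PathRep K G) (F : C(X, K)) (a b c : X) :
    h.along F b c * h.along F a b = h.along F a c := by
  rw [along, along, ← h.hol_trans, ← Path.map_trans, hol_map]

theorem along_self [SimplyConnectedSpace X] (h : PathRep K G) (F : C(X, K)) (a : X) :
    h.along F a a = 1 := by
  simpa using h.along_trans F a a a

theorem along_inv [SimplyConnectedSpace X] (h : PathRep K G) (F : C(X, K)) (a b : X) :
    (h.along F a b)⁻¹ = h.along F b a := by
  rw [inv_eq_iff_mul_eq_one, along_trans, along_self]

/-- Both sides are values on one loop: the image of a path from `x₀` to `x` followed by a path from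
`y` to `x₀`, which closes up because `F x = F y`. This is what makes the comparison of two bundles
with equal holonomy PE. -/
theorem along_inv_mul_along_eq [SimplyConnectedSpace X] {h h' : PathRep K G} (F : C(X, K))
    {x₀ x y : X} (e : h.toHom (F x₀) = h'.toHom (F x₀)) (hxy : F x = F y) :
    (h.along F x₀ y)⁻¹ * h.along F x₀ x = (h'.along F x₀ y)⁻¹ * h'.along F x₀ x := by
  let p : Path (F x₀) (F x) := (PathConnectedSpace.somePath x₀ x).map F.continuous
  let q : Path (F y) (F x₀) := (PathConnectedSpace.somePath y x₀).map F.continuous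
  have key : ∀ h : PathRep K G, (h.along F x₀ y)⁻¹ * h.along F x₀ x =
      h.hol (p.trans (q.cast hxy rfl)) := by
    intro h
    rw [h.hol_trans, h.along_inv, h.hol_congr (γ := q.cast hxy rfl) (γ' := q) fun _ => rfl]
    rfl
  rw [key h, key h', ← toHom_fromPath, ← toHom_fromPath, e]

/-- A homomorphism of the fundamental group of a space extends to a path representation, if the
base point is joined to every point. -/
theorem exists_toHom_eq [PathConnectedSpace K] (b : K) (ρ : FundamentalGroup K b →* G) :
    ∃ h : PathRep K G, h.toHom b = ρ := by
  classical
  -- The connecting path at `b` itself has to be trivial up to homotopy; with another loop the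
  -- construction would return a conjugate of `ρ`.
  let s : ∀ z, Path b z := fun z =>
    if e : b = z then (Path.refl b).cast rfl e.symm else PathConnectedSpace.somePath b z
  have hs : s b = Path.refl b := by simp [s]
  let q : ∀ {z w : K}, Path z w → FundamentalGroup K b := fun {z w} γ =>
    FundamentalGroup.fromPath (((Path.Homotopic.Quotient.mk (s z)).trans
      (Path.Homotopic.Quotient.mk γ)).trans (Path.Homotopic.Quotient.mk (s w)).symm)
  refine ⟨⟨fun γ => ρ (q γ), fun {z w γ γ'} e => ?_, fun {z w y} γ γ' => ?_⟩, ?_⟩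
  · have : Path.Homotopic.Quotient.mk γ = Path.Homotopic.Quotient.mk γ' :=
      Path.Homotopic.Quotient.eq.2 e
    simp only [q, this]
  · rw [← map_mul]
    congr 1
    rw [FundamentalGroup.mul_def]
    simp only [q]
    change _ = Path.Homotopic.Quotient.trans _ _
    rw [Path.Homotopic.Quotient.mk_trans]
    simp only [Path.Homotopic.Quotient.trans_assoc]
    rw [← Path.Homotopic.Quotient.trans_assoc (Path.Homotopic.Quotient.mk (s w)).symm,
      Path.Homotopic.Quotient.symm_trans, Path.Homotopic.Quotient.refl_trans]
  · ext p
    induction p using Quotient.inductionOn with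
    | _ p =>
      change ρ (q p) = _
      congr 1
      simp only [q, hs]
      rw [← Path.Homotopic.Quotient.mk_symm, Path.refl_symm, Path.Homotopic.Quotient.mk_refl,
        Path.Homotopic.Quotient.trans_refl, Path.Homotopic.Quotient.refl_trans]
      rfl

/-- A path representation that is locally trivialised by a frame `u` along a path is trivialised
by `u` on the whole path. -/
theorem hol_eq_of_cover (h : PathRep K G) {α : Type*} (O : α → Set K) (u : K → G) {z w : K}
    (γ : Path z w) (hO : ∀ i, IsOpen (O i)) (hc : ∀ a, ∃ i, γ a ∈ O i)
    (hu : ∀ i {z' w' : K} (γ' : Path z' w'), (∀ a, γ' a ∈ O i) → h.hol γ' = (u w')⁻¹ * u z') :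
    h.hol γ = (u w)⁻¹ * u z := by
  obtain ⟨s, hs0, hsm, ⟨n, hn⟩, hs⟩ := exists_monotone_Icc_subset_open_cover_unitInterval
    (c := fun i => γ ⁻¹' O i) (fun i => (hO i).preimage γ.continuous) (fun a _ => by simpa using hc a)
  have key : ∀ k, h.hol (γ.subpath 0 (s k)) = (u (γ (s k)))⁻¹ * u (γ 0) := by
    intro k
    induction k with
    | zero => rw [hs0, hol_subpath_self, inv_mul_cancel]
    | succ k ih =>
      obtain ⟨i, hi⟩ := hs k
      rw [← h.hol_subpath_trans γ 0 (s k), ih, hu i (γ.subpath (s k) (s (k + 1)))]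
      · group
      · intro a
        have : γ.subpath (s k) (s (k + 1)) a ∈ γ '' Icc (s k) (s (k + 1)) := by
          rw [← Path.range_subpath_of_le _ _ _ (hsm k.le_succ)]
          exact mem_range_self a
        obtain ⟨b, hb, e⟩ := this
        rw [← e]
        exact hi hb
  have := key n
  rw [hn n le_rfl, hol_subpath_zero_one] at this
  simpa using this

end PathRep

/-! ### Flat cocycles and their holonomy -/

/-- A locally constant cocycle on an open cover of `K`. -/
structure FlatCocycle (K : Type*) [TopologicalSpace K] (G : Type*) [Group G] where
  Index : Type*
  V : Index → Set K
  isOpen_V : ∀ i, IsOpen (V i)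
  cover : ∀ z, ∃ i, z ∈ V i
  H : Index → Index → K → G
  comp : ∀ i j k, ∀ z ∈ V i, z ∈ V j → z ∈ V k → H k j z * H j i z = H k i z
  locallyConstant : ∀ i j, ∀ z ∈ V j ∩ V i, ∀ᶠ w in 𝓝 z, H j i w = H j i z

namespace FlatCocycle

variable {K G : Type*} [TopologicalSpace K] [Group G] (C : FlatCocycle K G)

theorem H_self {i : C.Index} {z : K} (hz : z ∈ C.V i) : C.H i i z = 1 := by
  simpa using C.comp i i i z hz hz hz

/-- The fiber bundle core with discrete fiber given by a flat cocycle. -/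
@[reducible] def core (ind : K → C.Index) (hind : ∀ z, z ∈ C.V (ind z)) [TopologicalSpace G]
    [DiscreteTopology G] : FiberBundleCore C.Index K G where
  baseSet := C.V
  isOpen_baseSet := C.isOpen_V
  indexAt := ind
  mem_baseSet_at := hind
  coordChange i j z v := C.H j i z * v
  coordChange_self i z hz v := by rw [C.H_self hz, one_mul]
  continuousOn_coordChange i j := by
    intro p hp
    apply ContinuousAt.continuousWithinAt
    have : ∀ᶠ q in 𝓝 p, C.H j i p.1 * p.2 = C.H j i q.1 * q.2 := by
      have h1 := (continuous_fst.tendsto p).eventually (C.locallyConstant i j p.1 ⟨hp.1.2, hp.1.1⟩)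
      have h2 : ∀ᶠ q : K × G in 𝓝 p, q.2 = p.2 :=
        (continuous_snd.tendsto p).eventually (p := fun v => v = p.2)
          (by rw [nhds_discrete]; exact Filter.eventually_pure.2 rfl)
      filter_upwards [h1, h2] with q a b
      rw [a, b]
    exact (continuousAt_const.congr this)
  coordChange_comp i j k z hz v := by
    rw [← mul_assoc, C.comp i j k z hz.1.1 hz.1.2 hz.2]

/-- Transport is the monodromy of the covering space glued from the cocycle, with the fiber over `z`
read in the chart `ind z`. Right multiplication by `G` acts by deck transformations, so monodromy is
a left multiplication, determined by the image of `1`. The choice `ind` is a parameter so that the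
chart at the base point can be prescribed. -/
theorem exists_pathRep (ind : K → C.Index) (hind : ∀ z, z ∈ C.V (ind z)) :
    ∃ h : PathRep K G, ∀ i {z w : K} (γ : Path z w), (∀ a, γ a ∈ C.V i) →
      h.hol γ = C.H (ind w) i w * C.H i (ind z) z := by
  let : TopologicalSpace G := ⊥
  have : DiscreteTopology G := ⟨rfl⟩
  let Z := C.core ind hind
  have cov : IsCoveringMap Z.proj := FiberBundle.isCoveringMap (E := Z.Fiber)
  let mk : K → G → Z.TotalSpace := fun z g => ⟨z, g⟩
  let snd : Z.TotalSpace → G := fun e => e.2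
  let pt : ∀ z : K, G → Z.proj ⁻¹' {z} := fun z g => ⟨mk z g, rfl⟩
  have eta : ∀ {z : K} (e : Z.proj ⁻¹' {z}), pt z (snd e.1) = e := by
    rintro _ ⟨⟨z, g⟩, rfl⟩
    rfl
  have cont : ∀ v : G, Continuous fun e : Z.TotalSpace => mk e.1 (snd e * v) := by
    intro v
    rw [continuous_iff_continuousAt]
    intro e
    rw [FiberBundle.continuousAt_totalSpace]
    refine ⟨Z.continuous_proj.continuousAt, ?_⟩
    have h1 := ((FiberBundle.continuousAt_totalSpace G (E := Z.Fiber) (fun e => e)).1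
      (continuousAt_id (x := e))).2
    have h2 : ContinuousAt (fun e' : Z.TotalSpace => C.H (ind e.1) (ind e'.1) e'.1 * snd e') e := h1
    have h3 := (continuous_of_discreteTopology (f := fun g : G => g * v)).continuousAt.comp h2
    refine h3.congr (Eventually.of_forall fun e' => ?_)
    exact mul_assoc _ _ _
  -- A lift multiplied on the right by `g` is again a lift; uniqueness of lifts gives the
  -- equivariance of monodromy.
  have equi : ∀ {z w : K} (γ : Path.Homotopic.Quotient z w) (g : G),
      cov.monodromy γ (pt z g) = pt w (snd (cov.monodromy γ (pt z 1)).1 * g) := by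
    intro z w γ g
    induction γ with
    | mk γ =>
    let Γ := cov.liftPath γ (pt z 1).1 γ.source
    let Γ' : C(unitInterval, Z.TotalSpace) := ⟨fun a => mk (Γ a).1 (snd (Γ a) * g), (cont g).comp Γ.continuous⟩
    have hΓ : Γ' = cov.liftPath γ (pt z g).1 γ.source := by
      rw [cov.eq_liftPath_iff']
      refine ⟨cov.liftPath_lifts γ (pt z 1).1 γ.source, ?_⟩
      change mk (Γ 0).1 (snd (Γ 0) * g) = mk z g
      rw [show Γ 0 = mk z 1 from cov.liftPath_zero _ _ _]
      exact congrArg (mk z) (one_mul g)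
    apply Subtype.ext
    change cov.liftPath γ (pt z g).1 γ.source 1 = _
    rw [← hΓ]
    change mk (Γ 1).1 (snd (Γ 1) * g) = mk w (snd (Γ 1) * g)
    congr 1
    exact congr($(cov.liftPath_lifts ..) 1).trans γ.target
  refine ⟨⟨fun {z w} γ => snd (cov.monodromy (.mk γ) (pt z 1)).1, ?_, ?_⟩, ?_⟩
  · intro z w γ γ' e
    rw [Path.Homotopic.Quotient.eq.2 e]
  · intro z w y γ γ'
    rw [Path.Homotopic.Quotient.mk_trans, cov.monodromy_trans_apply,
      ← eta (cov.monodromy (.mk γ) (pt z 1)), equi]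
  · intro i z w γ hγ
    have : ∀ x, Nonempty (Z.Fiber x) := fun _ => ⟨(1 : G)⟩
    let e := Z.localTriv i
    let v := C.H i (ind z) z
    -- The lift that has the constant coordinate `v` in the chart `i`.
    let Γ : C(unitInterval, Z.TotalSpace) := ⟨fun a => mk (γ a) (C.H (ind (γ a)) i (γ a) * v), by
      have h1 : Continuous fun a => e.toOpenPartialHomeomorph.symm (γ a, v) := by
        refine e.toOpenPartialHomeomorph.continuousOn_symm.comp_continuous
          (f := fun a => (γ a, v)) (by fun_prop) fun a => ?_
        exact (Z.mem_localTriv_target i _).2 (hγ a)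
      exact h1⟩
    have hz : z ∈ C.V i := by simpa using hγ 0
    have hΓ : Γ = cov.liftPath γ (pt z 1).1 γ.source := by
      rw [cov.eq_liftPath_iff']
      refine ⟨rfl, ?_⟩
      change mk (γ 0) (C.H (ind (γ 0)) i (γ 0) * C.H i (ind z) z) = mk z 1
      rw [γ.source, C.comp _ _ _ z (hind z) hz (hind z), C.H_self (hind z)]
    change snd (cov.liftPath γ (pt z 1).1 γ.source 1) = _
    rw [← hΓ]
    change C.H (ind (γ 1)) i (γ 1) * C.H i (ind z) z = _
    rw [γ.target]

end FlatCocycle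

/-! ### The projection `ℝ^d → K_t` is a quotient map -/

namespace Tiling

variable {d : ℕ} {L : Type v}

theorem centeredPatch_add (T : Tiling d L) {t R : ℝ} {v : EuclideanSpace ℝ (Fin d)}
    (h : t + ‖v‖ ≤ R) (z : EuclideanSpace ℝ (Fin d)) :
    T.centeredPatch t (z + v) = Tile.translate (-v) ''
      {A ∈ T.centeredPatch R z | (A.carrier ∩ Metric.ball v t).Nonempty} := by
  have hb : Metric.ball (z + v) t ⊆ Metric.ball z R := by
    apply Metric.ball_subset_ball'
    rw [dist_self_add_left]
    exact h
  have e : ∀ A : Tile d L, A.translate (-(z + v)) = (A.translate (-z)).translate (-v) := by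
    intro A
    rw [Tile.translate_translate]
    congr 1
    abel
  ext A
  constructor
  · rintro ⟨B, hB, rfl⟩
    refine ⟨B.translate (-z), ⟨⟨B, ⟨hB.1, hB.2.mono (inter_subset_inter_right _ hb)⟩, rfl⟩, ?_⟩,
      (e B).symm⟩
    rw [meets_translate, sub_neg_eq_add, add_comm]
    exact hB.2
  · rintro ⟨_, ⟨⟨B, hB, rfl⟩, hA⟩, rfl⟩
    rw [meets_translate, sub_neg_eq_add, add_comm] at hA
    exact ⟨B, ⟨hB.1, hA⟩, e B⟩

theorem centeredPatch_add_eq {T S : Tiling d L} {t R : ℝ} {v x y : EuclideanSpace ℝ (Fin d)}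
    (h : T.centeredPatch R x = S.centeredPatch R y) (hv : t + ‖v‖ ≤ R) :
    T.centeredPatch t (x + v) = S.centeredPatch t (y + v) := by
  rw [centeredPatch_add T hv, centeredPatch_add S hv, h]

theorem centeredPatch_translate (T : Tiling d L) (t : ℝ) (w x : EuclideanSpace ℝ (Fin d)) :
    (T.translate w).centeredPatch t x = T.centeredPatch t (x - w) := by
  have e : ∀ A : Tile d L, (A.translate w).translate (-x) = A.translate (-(x - w)) := by
    intro A
    rw [Tile.translate_translate]
    congr 1
    abel
  ext A
  constructor
  · rintro ⟨_, ⟨⟨B, hB, rfl⟩, hA⟩, rfl⟩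
    exact ⟨B, ⟨hB, (meets_translate _ _ _ _).1 hA⟩, (e B).symm⟩
  · rintro ⟨B, hB, rfl⟩
    exact ⟨B.translate w, ⟨⟨B, hB.1, rfl⟩, (meets_translate _ _ _ _).2 hB.2⟩, e B⟩

theorem centeredPatch_zero (T : Tiling d L) (t : ℝ) : T.centeredPatch t 0 = T.patch t 0 := by
  ext A
  simp [centeredPatch, Tile.translate_zero]

/-- The topology is defined by its open sets, so the expected basic neighborhoods have to be shown
open. Near a member with shift `v`, the remaining shift is `ε - ‖v‖`, and agreement is needed on
radius `r + ‖v‖` to survive the shift by `v`. -/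
theorem isOpen_setOf_patch_eq (T : Tiling d L) (r ε : ℝ) :
    IsOpen {S : Tiling d L | ∃ v, ‖v‖ < ε ∧ (S.translate v).patch r 0 = T.patch r 0} := by
  rintro S ⟨v, hv, hS⟩
  refine ⟨r + ‖v‖, ε - ‖v‖, sub_pos.2 hv, ?_⟩
  rintro S' ⟨w, hw, hS'⟩
  refine ⟨w + v, (norm_add_le _ _).trans_lt (by linarith), ?_⟩
  rw [← centeredPatch_zero, ← centeredPatch_zero, centeredPatch_translate] at hS hS' ⊢
  have := centeredPatch_add_eq (t := r) (v := -v) hS' (by rw [norm_neg])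
  rw [← hS, show (0 : EuclideanSpace ℝ (Fin d)) - (w + v) = 0 - w + -v by abel, this]
  congr 1

/-- Every patch of a tiling in the tiling space of `T` is a translate of a patch of `T`. -/
theorem exists_centeredPatch_eq {T S : Tiling d L} (hS : S ∈ T.hull) (R : ℝ)
    (x : EuclideanSpace ℝ (Fin d)) : ∃ y, S.centeredPatch R x = T.centeredPatch R y := by
  obtain ⟨_, ⟨v, -, hv⟩, w, rfl⟩ := mem_closure_iff.1 hS _
    (isOpen_setOf_patch_eq S (R + ‖x‖) 1) ⟨0, by simp, by rw [translate_zero]⟩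
  rw [← centeredPatch_zero, ← centeredPatch_zero, centeredPatch_translate] at hv
  have := centeredPatch_add_eq (t := R) (v := x) hv le_rfl
  rw [centeredPatch_translate, zero_add] at this
  exact ⟨_, this.symm⟩

end Tiling

section Approximants

variable {d : ℕ} {L : Type v} (T : Tiling d L)

theorem approximantProj_eq_iff {t : ℝ} {x y : EuclideanSpace ℝ (Fin d)} :
    approximantProj T t x = approximantProj T t y ↔ T.centeredPatch t x = T.centeredPatch t y :=
  Quotient.eq (r := approximantSetoid T t)

theorem approximantProj_surjective (t : ℝ) : Function.Surjective (approximantProj T t) := by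
  intro z
  induction z using Quotient.inductionOn with
  | _ p =>
    obtain ⟨y, hy⟩ := Tiling.exists_centeredPatch_eq p.1.2 t p.2
    exact ⟨y, Quotient.sound (s := approximantSetoid T t) hy.symm⟩

theorem continuous_approximantProj (t : ℝ) : Continuous (approximantProj T t) :=
  (continuous_quotient_mk' (s := approximantSetoid T t)).comp (by fun_prop)

/-- A pair `(S', x')` close to `(S, x)` has, at radius `t`, the patch found in `T` at a point close
to `y`, where `y` is a place of `T` that looks like `(S, x)` up to radius `t + 1`. Hence openness in
`K_t` can be tested on `ℝ^d` alone. -/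
theorem isQuotientMap_approximantProj (t : ℝ) : IsQuotientMap (approximantProj T t) := by
  refine (isQuotientMap_iff _).2 ⟨isCoinducing_iff.2 fun V =>
    ⟨fun hV => ?_, fun hV => hV.preimage (continuous_approximantProj T t)⟩,
    approximantProj_surjective T t⟩
  refine isOpen_coinduced.2 (isOpen_iff_mem_nhds.2 ?_)
  rintro ⟨⟨S, hS⟩, x⟩ hx
  obtain ⟨y, hy⟩ := Tiling.exists_centeredPatch_eq hS (t + 1) x
  have hyV : approximantProj T t y ∈ V := by
    have h0 : approximantProj T t y = Quotient.mk (approximantSetoid T t) (⟨S, hS⟩, x) :=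
      Quotient.sound (s := approximantSetoid T t)
        (Tiling.centeredPatch_eq_of_le (by linarith) hy.symm)
    rw [h0]
    exact hx
  obtain ⟨δ, hδ, hball⟩ := Metric.isOpen_iff.1 hV y hyV
  let ε := min δ 1 / 2
  have hε : 0 < ε := by positivity
  have hε1 : ε + ε ≤ 1 := by simp [ε]
  have hεδ : ε + ε ≤ δ := by simp [ε]
  -- Closeness of tilings compares patches at the origin. The radius must cover the ball of radius
  -- `t` around `x' + v`, a point at distance less than `1` from `x`.
  have hN := (Tiling.isOpen_setOf_patch_eq S (t + (‖x‖ + 1)) ε).mem_nhds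
    ⟨0, by simpa using hε, by rw [Tiling.translate_zero]⟩
  have := prod_mem_nhds ((continuous_subtype_val (p := (· ∈ T.hull))).continuousAt.preimage_mem_nhds
    (x := ⟨S, hS⟩) hN) (Metric.ball_mem_nhds x hε)
  filter_upwards [this]
  rintro ⟨⟨S', hS'⟩, x'⟩ ⟨⟨v, hv, hSv⟩, hx'⟩
  rw [mem_ball_iff_norm] at hx'
  have hn : ‖x' + v - x‖ < ε + ε := by
    rw [show x' + v - x = (x' - x) + v by abel]
    exact (norm_add_le _ _).trans_lt (add_lt_add hx' hv)
  rw [← Tiling.centeredPatch_zero, ← Tiling.centeredPatch_zero] at hSv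
  have h1 := Tiling.centeredPatch_add_eq (t := t) (v := x' + v) hSv (by
    have : ‖x' + v‖ ≤ ‖x‖ + ‖x' + v - x‖ := by
      simpa using norm_add_le x (x' + v - x)
    linarith)
  have h2 := Tiling.centeredPatch_add_eq (t := t) (v := x' + v - x) hy (by linarith)
  rw [Tiling.centeredPatch_translate, zero_add, add_sub_cancel_right] at h1
  rw [add_sub_cancel] at h2
  have h3 : y + (x' + v - x) ∈ approximantProj T t ⁻¹' V := by
    apply hball
    rw [mem_ball_iff_norm, add_sub_cancel_left]
    linarith
  have h4 : approximantProj T t (y + (x' + v - x)) =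
      Quotient.mk (approximantSetoid T t) (⟨S', hS'⟩, x') :=
    Quotient.sound (s := approximantSetoid T t) (h1.trans h2).symm
  rw [mem_preimage, h4] at h3
  exact h3

/-! ### Descent of PE sets and PE functions to `K_t`. -/

theorem approximantProj_mem_image {t s : ℝ} (hst : s ≤ t) {U : Set (EuclideanSpace ℝ (Fin d))}
    (hU : IsPEOpen T s U) {x : EuclideanSpace ℝ (Fin d)} :
    approximantProj T t x ∈ approximantProj T t '' U ↔ x ∈ U := by
  refine ⟨?_, mem_image_of_mem _⟩
  rintro ⟨y, hy, e⟩
  exact hU.2 y hy x (Tiling.centeredPatch_eq_of_le hst ((approximantProj_eq_iff T).1 e))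

theorem isOpen_image_approximantProj {t s : ℝ} (hst : s ≤ t)
    {U : Set (EuclideanSpace ℝ (Fin d))} (hU : IsPEOpen T s U) :
    IsOpen (approximantProj T t '' U) := by
  rw [← (isQuotientMap_approximantProj T t).isOpen_preimage]
  convert hU.1 using 1
  ext x
  exact approximantProj_mem_image T hst hU

/-- A point of `ℝ^d` over a given point of `K_t`. -/
noncomputable def approximantLift {t : ℝ} : Approximant T t → EuclideanSpace ℝ (Fin d) :=
  Function.surjInv (approximantProj_surjective T t)

theorem approximantProj_lift {t : ℝ} (z : Approximant T t) :
    approximantProj T t (approximantLift T z) = z :=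
  Function.surjInv_eq _ z

theorem lift_mem {t s : ℝ} (hst : s ≤ t) {U : Set (EuclideanSpace ℝ (Fin d))}
    (hU : IsPEOpen T s U) {z : Approximant T t} (hz : z ∈ approximantProj T t '' U) :
    approximantLift T z ∈ U := by
  rwa [← approximantProj_mem_image T hst hU, approximantProj_lift]

variable {T} in
theorem IsPEOn.apply_lift {α : Type*} {t s : ℝ} (hst : s ≤ t)
    {U : Set (EuclideanSpace ℝ (Fin d))} {f : EuclideanSpace ℝ (Fin d) → α}
    (hU : IsPEOpen T s U) (hf : IsPEOn T s U f) {x : EuclideanSpace ℝ (Fin d)} (hx : x ∈ U) :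
    f (approximantLift T (approximantProj T t x)) = f x := by
  refine hf _ (lift_mem T hst hU (mem_image_of_mem _ hx)) _ hx
    (Tiling.centeredPatch_eq_of_le hst ((approximantProj_eq_iff T).1 ?_))
  rw [approximantProj_lift]

variable {T} in
/-- The function on the approximant given by a PE function is continuous if the latter is. -/
theorem IsPEOn.continuousOn_comp_lift {α : Type*} [TopologicalSpace α] {t s : ℝ} (hst : s ≤ t)
    {U : Set (EuclideanSpace ℝ (Fin d))} {f : EuclideanSpace ℝ (Fin d) → α}
    (hU : IsPEOpen T s U) (hf : IsPEOn T s U f) (hc : ContinuousOn f U) :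
    ContinuousOn (fun z => f (approximantLift T z)) (approximantProj T t '' U) := by
  rw [continuousOn_open_iff (isOpen_image_approximantProj T hst hU)]
  intro O hO
  rw [← (isQuotientMap_approximantProj T t).isOpen_preimage]
  convert (continuousOn_open_iff hU.1).1 hc O hO using 1
  ext x
  simp only [mem_preimage, mem_inter_iff, approximantProj_mem_image T hst hU]
  exact and_congr_right fun hx => by rw [hf.apply_lift hst hU hx]

-- `approximantLift` is an arbitrary section and need not be continuous, but a PE function does not
-- see the choice. Local constancy is continuity for the discrete topology on `α`, which descends
-- along the quotient map.
variable {T} in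
theorem IsPEOn.eventually_lift_eq {α : Type*} {t s : ℝ} (hst : s ≤ t)
    {U : Set (EuclideanSpace ℝ (Fin d))} {f : EuclideanSpace ℝ (Fin d) → α}
    (hU : IsPEOpen T s U) (hf : IsPEOn T s U f) (hc : IsLocallyConstantOn U f)
    {z : Approximant T t} (hz : z ∈ approximantProj T t '' U) :
    ∀ᶠ w in 𝓝 z, f (approximantLift T w) = f (approximantLift T z) := by
  let : TopologicalSpace α := ⊥
  have : DiscreteTopology α := ⟨rfl⟩
  have h1 := hf.continuousOn_comp_lift (t := t) hst hU
    (continuousOn_iff_continuous_domRestrict.2 hc.continuous)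
  have h2 := h1.continuousAt ((isOpen_image_approximantProj T hst hU).mem_nhds hz)
  exact h2.eventually (p := fun v => v = f (approximantLift T z))
    (by rw [nhds_discrete]; exact Filter.eventually_pure.2 rfl)

theorem IsPEOpen.mono {s t : ℝ} (hst : s ≤ t) {U : Set (EuclideanSpace ℝ (Fin d))}
    (h : IsPEOpen T s U) : IsPEOpen T t U :=
  ⟨h.1, fun x hx y hxy => h.2 x hx y (Tiling.centeredPatch_eq_of_le hst hxy)⟩

theorem IsPEOpen.inter {s : ℝ} {U V : Set (EuclideanSpace ℝ (Fin d))}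
    (hU : IsPEOpen T s U) (hV : IsPEOpen T s V) : IsPEOpen T s (U ∩ V) :=
  ⟨hU.1.inter hV.1, fun x hx y hxy => ⟨hU.2 x hx.1 y hxy, hV.2 x hx.2 y hxy⟩⟩

instance (t : ℝ) : PathConnectedSpace (Approximant T t) :=
  (approximantProj_surjective T t).pathConnectedSpace (continuous_approximantProj T t)

end Approximants

/-! ### Holonomy of flat PE bundles -/

section

variable {d : ℕ} {L : Type v} {T : Tiling d L}

theorem IsPEOn.apply_lift_eq_of_path {α : Type*} {t s : ℝ} (hst : s ≤ t)
    {U : Set (EuclideanSpace ℝ (Fin d))} {f : EuclideanSpace ℝ (Fin d) → α}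
    (hU : IsPEOpen T s U) (hf : IsPEOn T s U f) (hc : IsLocallyConstantOn U f)
    {z w : Approximant T t} (γ : Path z w) (hγ : ∀ a, γ a ∈ approximantProj T t '' U) :
    f (approximantLift T w) = f (approximantLift T z) := by
  have : IsLocallyConstant fun a => f (approximantLift T (γ a)) :=
    (IsLocallyConstant.iff_eventually_eq _).2 fun a =>
      (γ.continuous.tendsto a).eventually (hf.eventually_lift_eq hst hU hc (hγ a))
  simpa using this.apply_eq_of_preconnectedSpace 1 0

variable (T) in
/-- The projection to the approximant as a continuous map. -/
def approximantProjMap (t : ℝ) : C(EuclideanSpace ℝ (Fin d), Approximant T t) :=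
  ⟨approximantProj T t, continuous_approximantProj T t⟩

end

namespace FlatBasedPEBundle

variable {d : ℕ} {L : Type v} {T : Tiling d L} {G : Type u} [Group G] [TopologicalSpace G]
  {x₀ : EuclideanSpace ℝ (Fin d)} (P Q : FlatBasedPEBundle T G x₀)

theorem transition_comp (i j k : P.Index) {x : EuclideanSpace ℝ (Fin d)} (hi : x ∈ P.U i)
    (hj : x ∈ P.U j) (hk : x ∈ P.U k) :
    P.transition k j x * P.transition j i x = P.transition k i x := by
  have h1 := P.chart_eq i j x hi hj 1
  rw [P.chart_eq j k x hj hk, P.chart_eq i k x hi hk] at h1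
  simpa using (P.chart_inj h1).symm

/-- `h` is the parallel transport of the bundle `P` on `K_t`, and `u i z` is the coordinate in the
chart `i` of the reference point of the fiber over `z`. -/
structure IsFrame (t : ℝ) (h : PathRep (Approximant T t) G)
    (u : P.Index → Approximant T t → G) : Prop where
  change : ∀ i j x, x ∈ P.U i → x ∈ P.U j →
    u j (approximantProj T t x) = P.transition j i x * u i (approximantProj T t x)
  hol : ∀ i {z w : Approximant T t} (γ : Path z w), (∀ a, γ a ∈ approximantProj T t '' P.U i) →
    h.hol γ = (u i w)⁻¹ * u i z
  base : u P.baseIndex (approximantProj T t x₀) = 1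

/-- The flat cocycle on `K_t` given by a flat bundle of radius at most `t`. -/
noncomputable def cocycle {t : ℝ} (ht : P.radius ≤ t) : FlatCocycle (Approximant T t) G where
  Index := P.Index
  V i := approximantProj T t '' P.U i
  isOpen_V i := isOpen_image_approximantProj T ht (P.isPEOpen_U i)
  cover z := by
    obtain ⟨x, rfl⟩ := approximantProj_surjective T t z
    exact (P.cover_U x).imp fun i hi => mem_image_of_mem _ hi
  H j i z := P.transition j i (approximantLift T z)
  comp i j k z hi hj hk := P.transition_comp i j k (lift_mem T ht (P.isPEOpen_U i) hi)
    (lift_mem T ht (P.isPEOpen_U j) hj) (lift_mem T ht (P.isPEOpen_U k) hk)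
  locallyConstant i j z hz := by
    refine (P.isPEOn_transition i j).eventually_lift_eq ht
      ((P.isPEOpen_U j).inter T (P.isPEOpen_U i)) (P.flat i j) ?_
    exact ⟨_, ⟨lift_mem T ht (P.isPEOpen_U j) hz.1, lift_mem T ht (P.isPEOpen_U i) hz.2⟩,
      approximantProj_lift T z⟩

theorem exists_isFrame {t : ℝ} (ht : P.radius ≤ t) :
    ∃ (h : PathRep (Approximant T t) G) (u : P.Index → Approximant T t → G), P.IsFrame t h u := by
  classical
  let C := P.cocycle ht
  -- The reference chart at the base point is forced to be the base chart, so that the frame has the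
  -- value `1` there.
  have cov : ∀ z, ∃ i, z ∈ C.V i ∧ (z = approximantProj T t x₀ → i = P.baseIndex) := by
    intro z
    by_cases hz : z = approximantProj T t x₀
    · exact ⟨P.baseIndex, hz ▸ mem_image_of_mem _ P.base_mem, fun _ => rfl⟩
    · exact (C.cover z).imp fun i hi => ⟨hi, fun e => absurd e hz⟩
  choose ind hind hbase using cov
  obtain ⟨h, hh⟩ := C.exists_pathRep ind hind
  refine ⟨h, fun i z => C.H i (ind z) z, ?_, ?_, ?_⟩
  · intro i j x hi hj
    have hi' : approximantProj T t x ∈ C.V i := mem_image_of_mem _ hi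
    have hj' : approximantProj T t x ∈ C.V j := mem_image_of_mem _ hj
    rw [← C.comp _ i j _ (hind _) hi' hj']
    congr 1
    exact (P.isPEOn_transition i j).apply_lift ht ((P.isPEOpen_U j).inter T (P.isPEOpen_U i))
      ⟨hj, hi⟩
  · intro i z w γ hγ
    rw [hh i γ hγ]
    congr 1
    have hw : w ∈ C.V i := γ.target ▸ hγ 1
    rw [eq_inv_iff_mul_eq_one, C.comp _ _ _ w (hind w) hw (hind w), C.H_self (hind w)]
  · rw [hbase _ rfl]
    exact C.H_self (mem_image_of_mem _ P.base_mem)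

variable {P Q}

/-- On each piece the transport is a quotient of two frame values. At a division point the frames of
consecutive charts differ by the transition function, so the product telescopes, and the outer
values are `1` by `IsFrame.base`. -/
theorem IsFrame.isHolonomy {t : ℝ} (ht : P.radius ≤ t) {h : PathRep (Approximant T t) G}
    {u : P.Index → Approximant T t → G} (hu : P.IsFrame t h u) :
    P.IsHolonomy t (h.toHom (approximantProj T t x₀)) := by
  intro γ m s j y hs hs0 hs1 hj0 hjm hγ hy
  have sub : ∀ k ≤ m, h.hol (γ.subpath (s k) (s (k + 1))) =
      (u (j k) (γ (s (k + 1))))⁻¹ * u (j k) (γ (s k)) := by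
    intro k hk
    refine hu.hol _ _ fun a => ?_
    have : γ.subpath (s k) (s (k + 1)) a ∈ γ '' Icc (s k) (s (k + 1)) := by
      rw [← Path.range_subpath_of_le _ _ _ (hs k.le_succ)]
      exact mem_range_self a
    obtain ⟨b, hb, e⟩ := this
    rw [← e]
    exact hγ k hk b hb
  have key : ∀ k ≤ m, h.hol (γ.subpath 0 (s (k + 1))) =
      (u (j k) (γ (s (k + 1))))⁻¹ * P.transport j y k := by
    intro k
    induction k with
    | zero =>
      intro hk
      have := sub 0 hk
      have e : u (j 0) (γ (s 0)) = 1 := by rw [hs0, hj0, γ.source, hu.base]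
      rw [e, hs0] at this
      exact this
    | succ k ih =>
      intro hk
      have hk' : k < m := hk
      rw [← h.hol_subpath_trans γ 0 (s (k + 1)), ih hk'.le, sub (k + 1) hk, transport]
      have e := hy k hk'
      have h1 : y k ∈ P.U (j k) := by
        rw [← approximantProj_mem_image T ht (P.isPEOpen_U _), e]
        exact hγ k hk'.le _ ⟨hs k.le_succ, le_rfl⟩
      have h2 : y k ∈ P.U (j (k + 1)) := by
        rw [← approximantProj_mem_image T ht (P.isPEOpen_U _), e]
        exact hγ (k + 1) hk _ ⟨le_rfl, hs (k + 1).le_succ⟩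
      have h3 := hu.change _ _ _ h1 h2
      rw [e] at h3
      rw [h3]
      group
  rw [PathRep.toHom_fromPath, ← h.hol_subpath_zero_one, ← hs1, key m le_rfl, hs1, hjm, γ.target,
    hu.base]
  simp

/-- Every loop has a subdivision of the kind used in the definition, by compactness of the interval,
and this determines the value. -/
theorem IsHolonomy.unique {t : ℝ} (ht : P.radius ≤ t) {ρ ρ' : approximantPi1 T x₀ t →* G}
    (h : P.IsHolonomy t ρ) (h' : P.IsHolonomy t ρ') : ρ = ρ' := by
  ext p
  induction p using Quotient.inductionOn with
  | _ γ =>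
  obtain ⟨s, hs0, hsm, ⟨n, hn⟩, hs⟩ := exists_monotone_Icc_subset_open_cover_unitInterval
    (c := fun i => γ ⁻¹' (approximantProj T t '' P.U i))
    (fun i => (isOpen_image_approximantProj T ht (P.isPEOpen_U i)).preimage γ.continuous)
    (fun a _ => mem_iUnion.2 ((P.cocycle ht).cover (γ a)))
  choose i hi using hs
  choose y hy using approximantProj_surjective T t
  -- A subdivision must begin and end in the base chart, so constant pieces at times `0` and `1` are
  -- added. With division points `s (k - 1)`, truncated subtraction makes piece `0` equal to `{0}`,
  -- and piece `n + 1` is `{1}` since `s` is `1` from `n` on.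
  let j : ℕ → P.Index := fun k => if k = 0 ∨ k = n + 1 then P.baseIndex else i (k - 1)
  have hj : ∀ k ≤ n + 1, ∀ a ∈ Icc (s (k - 1)) (s (k + 1 - 1)),
      γ a ∈ approximantProj T t '' P.U (j k) := by
    intro k hk a ha
    rcases Nat.eq_zero_or_pos k with rfl | hk0
    · have : a = 0 := by simpa [hs0] using ha
      rw [this, γ.source]
      exact mem_image_of_mem _ P.base_mem
    · rcases hk.eq_or_lt with rfl | hk1
      · have : a = 1 := by simpa [hn n le_rfl, hn (n + 1) n.le_succ] using ha
        rw [this, γ.target]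
        simpa [j] using mem_image_of_mem _ P.base_mem
      · obtain ⟨k, rfl⟩ := Nat.exists_eq_add_of_le' hk0
        have : j (k + 1) = i k := by simp [j, (Nat.lt_of_succ_lt_succ hk1).ne]
        rw [this]
        exact hi k ha
  have hs' : Monotone fun k => s (k - 1) := fun a b hab => hsm (Nat.sub_le_sub_right hab 1)
  have e := h γ (n + 1) (fun k => s (k - 1)) j (fun k => y (γ (s k))) hs' hs0
    (hn _ n.le_succ) (by simp [j]) (by simp [j]) hj (fun k _ => hy _)
  have e' := h' γ (n + 1) (fun k => s (k - 1)) j (fun k => y (γ (s k))) hs' hs0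
    (hn _ n.le_succ) (by simp [j]) (by simp [j]) hj (fun k _ => hy _)
  exact e.trans e'.symm

theorem IsHolonomy.forget {s t : ℝ} (hst : s ≤ t) {ρ : approximantPi1 T x₀ s →* G}
    (h : P.IsHolonomy s ρ) : P.IsHolonomy t (forgetfulDual T x₀ G hst ρ) := by
  intro γ m a j y ha ha0 ha1 hj0 hjm hγ hy
  refine Eq.trans ?_ (h (γ.map (forgetful T hst).continuous) m a j y ha ha0 ha1 hj0 hjm ?_ ?_)
  · change ρ (forgetfulPi1 T x₀ hst _) = _
    rw [forgetfulPi1, FundamentalGroup.mapOfEq_apply]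
    rfl
  · intro k hk b hb
    obtain ⟨x, hx, e⟩ := hγ k hk b hb
    refine ⟨x, hx, ?_⟩
    exact congrArg (forgetful T hst) e
  · intro k hk
    exact congrArg (forgetful T hst) (hy k hk)

/-- Applying the isomorphism to the reference points gives a frame of `Q` for the same `h`. Its
local form `l` is locally constant only on intersections of charts of `P` and `Q`, so the formula on
a chart of `Q` is assembled by `hol_eq_of_cover`. At `x₀` the value of `l` is `1` because base
points correspond. -/
theorem IsFrame.exists_of_isoAt {s t : ℝ} (hP : P.radius ≤ s) (hQ : Q.radius ≤ s) (hst : s ≤ t)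
    (hPQ : P.IsoAt Q s) {h : PathRep (Approximant T t) G}
    {u : P.Index → Approximant T t → G} (hu : P.IsFrame t h u) :
    ∃ u' : Q.Index → Approximant T t → G, Q.IsFrame t h u' := by
  obtain ⟨e, he, hb, hl⟩ := hPQ
  choose l hPE hLC hl using hl
  choose c hc using P.cover_U
  have l_change : ∀ i i' j x (_ : x ∈ P.U i) (_ : x ∈ P.U i') (_ : x ∈ Q.U j),
      l i' j x * P.transition i' i x = l i j x := by
    intro i i' j x hi hi' hj
    have h1 := hl i j x hi hj 1
    rw [P.chart_eq i i' x hi hi', hl i' j x hi' hj] at h1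
    simpa using Q.chart_inj h1
  have l_change' : ∀ i j j' x (_ : x ∈ P.U i) (_ : x ∈ Q.U j) (_ : x ∈ Q.U j'),
      l i j' x = Q.transition j' j x * l i j x := by
    intro i j j' x hi hj hj'
    have h1 := hl i j' x hi hj' 1
    rw [hl i j x hi hj, Q.chart_eq j j' x hj hj'] at h1
    simpa using (Q.chart_inj h1).symm
  let u' : Q.Index → Approximant T t → G := fun j z =>
    l (c (approximantLift T z)) j (approximantLift T z) * u (c (approximantLift T z)) z
  have key : ∀ i j x, x ∈ P.U i → x ∈ Q.U j →
      u' j (approximantProj T t x) = l i j x * u i (approximantProj T t x) := by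
    intro i j x hi hj
    have hxy : T.centeredPatch s (approximantLift T (approximantProj T t x)) =
        T.centeredPatch s x := by
      apply Tiling.centeredPatch_eq_of_le hst
      rw [← approximantProj_eq_iff, approximantProj_lift]
    simp only [u']
    generalize approximantLift T (approximantProj T t x) = y at hxy
    have hx' : x ∈ P.U (c y) := ((P.isPEOpen_U _).mono T hP).2 y (hc y) x hxy
    have hy : y ∈ Q.U j := ((Q.isPEOpen_U _).mono T hQ).2 x hj y hxy.symm
    rw [hPE (c y) j y ⟨hc y, hy⟩ x ⟨hx', hj⟩ hxy, hu.change i (c y) x hi hx', ← mul_assoc,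
      l_change i (c y) j x hi hx' hj]
  have open_ij : ∀ i j, IsPEOpen T s (P.U i ∩ Q.U j) := fun i j =>
    ((P.isPEOpen_U i).mono T hP).inter T ((Q.isPEOpen_U j).mono T hQ)
  refine ⟨u', ?_, ?_, ?_⟩
  · intro i j x hi hj
    rw [key (c x) i x (hc x) hi, key (c x) j x (hc x) hj, ← mul_assoc,
      l_change' (c x) i j x (hc x) hi hj]
  · intro j z w γ hγ
    refine h.hol_eq_of_cover (fun i => approximantProj T t '' (P.U i ∩ Q.U j)) (u' j) γ
      (fun i => isOpen_image_approximantProj T hst (open_ij i j)) ?_ ?_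
    · intro a
      obtain ⟨x, hx, e⟩ := hγ a
      exact ⟨c x, x, ⟨hc x, hx⟩, e⟩
    · intro i z' w' γ' hγ'
      have val : ∀ z ∈ approximantProj T t '' (P.U i ∩ Q.U j),
          u' j z = l i j (approximantLift T z) * u i z := by
        rintro _ ⟨x, hx, rfl⟩
        rw [key i j x hx.1 hx.2, (hPE i j).apply_lift hst (open_ij i j) hx]
      rw [hu.hol i γ' fun a => image_mono inter_subset_left (hγ' a),
        val z' (by simpa using hγ' 0), val w' (by simpa using hγ' 1),
        (hPE i j).apply_lift_eq_of_path hst (open_ij i j) (hLC i j) γ' hγ']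
      group
  · rw [key P.baseIndex Q.baseIndex x₀ P.base_mem Q.base_mem, hu.base, mul_one]
    have h1 := hl P.baseIndex Q.baseIndex x₀ P.base_mem Q.base_mem 1
    rw [P.chart_base, hb, ← Q.chart_base] at h1
    simpa using (Q.chart_inj h1).symm

theorem IsHolonomy.of_isoAt {s t : ℝ} (hP : P.radius ≤ s) (hQ : Q.radius ≤ s) (hst : s ≤ t)
    (hPQ : P.IsoAt Q s) {ρ : approximantPi1 T x₀ t →* G} (hρ : P.IsHolonomy t ρ) :
    Q.IsHolonomy t ρ := by
  obtain ⟨h, u, hu⟩ := P.exists_isFrame (hP.trans hst)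
  obtain ⟨u', hu'⟩ := hu.exists_of_isoAt hP hQ hst hPQ
  rw [hρ.unique (hP.trans hst) (hu.isHolonomy (hP.trans hst))]
  exact hu'.isHolonomy (hQ.trans hst)

/-! ### Bundles with equal holonomy are isomorphic -/

variable (P) in
/-- A locally constant frame of the bundle `P` over `ℝ^d`. -/
structure IsFlatSection (φ : P.Index → EuclideanSpace ℝ (Fin d) → G) : Prop where
  change : ∀ i j x, x ∈ P.U i → x ∈ P.U j → φ j x = P.transition j i x * φ i x
  flat : ∀ i, IsLocallyConstantOn (P.U i) (φ i)

/-- The frame `u` need not be locally constant, since its reference points are arbitrary.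
Transporting from `x₀` cancels this: inside a ball in a chart the transport from `x` to `y` is `(u i
y)⁻¹ * u i x`. -/
theorem IsFrame.isFlatSection {t : ℝ} {h : PathRep (Approximant T t) G}
    {u : P.Index → Approximant T t → G} (hu : P.IsFrame t h u) :
    P.IsFlatSection fun i x =>
      u i (approximantProj T t x) * h.along (approximantProjMap T t) x₀ x := by
  refine ⟨fun i j x hi hj => ?_, fun i => ?_⟩
  · rw [hu.change i j x hi hj, mul_assoc]
  · rw [isLocallyConstantOn_iff]
    intro x hx
    rw [(P.isPEOpen_U i).1.nhdsWithin_eq hx]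
    obtain ⟨δ, hδ, hball⟩ := Metric.isOpen_iff.1 (P.isPEOpen_U i).1 x hx
    filter_upwards [Metric.ball_mem_nhds x hδ] with y hy
    obtain ⟨p, hp⟩ := ((convex_ball x δ).isPathConnected ⟨x, Metric.mem_ball_self hδ⟩).joinedIn x
      (Metric.mem_ball_self hδ) y hy
    have h1 := hu.hol i (p.map (approximantProjMap T t).continuous)
      fun a => mem_image_of_mem _ (hball (hp a))
    rw [h.hol_map] at h1
    rw [← h.along_trans (approximantProjMap T t) x₀ x y, h1]
    simp [approximantProjMap, mul_assoc]

theorem IsFlatSection.exists_homeomorph [IsTopologicalGroup G]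
    {φ : P.Index → EuclideanSpace ℝ (Fin d) → G} (hφ : P.IsFlatSection φ) :
    ∃ e : EuclideanSpace ℝ (Fin d) × G ≃ₜ P.Total, ∀ i x (hi : x ∈ P.U i) g,
      e (x, g) = P.chart i (⟨x, hi⟩, φ i x * g) := by
  choose c hc using P.cover_U
  let f : EuclideanSpace ℝ (Fin d) × G → P.Total := fun p =>
    P.chart (c p.1) (⟨p.1, hc p.1⟩, φ (c p.1) p.1 * p.2)
  have hf : ∀ i x (hi : x ∈ P.U i) g, f (x, g) = P.chart i (⟨x, hi⟩, φ i x * g) := by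
    intro i x hi g
    simp only [f]
    rw [P.chart_eq (c x) i x (hc x) hi, hφ.change (c x) i x (hc x) hi, mul_assoc]
  have hproj : ∀ p, P.proj (f p) = p.1 := fun p => P.proj_chart _ _
  have inj : Function.Injective f := by
    rintro ⟨x, g⟩ ⟨y, k⟩ e
    obtain rfl : x = y := by simpa [hproj] using congrArg P.proj e
    simpa using P.chart_inj e
  have surj : Function.Surjective f := by
    intro p
    obtain ⟨⟨x, g⟩, e⟩ := (P.chart (c (P.proj p))).surjective ⟨p, hc _⟩
    refine ⟨(x.1, (φ (c (P.proj p)) x.1)⁻¹ * g), ?_⟩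
    rw [hf (c (P.proj p)) x.1 x.2, mul_inv_cancel_left]
    exact congrArg Subtype.val e
  let E := Equiv.ofBijective f ⟨inj, surj⟩
  have hE : ∀ i (q : P.U i × G), E.symm (P.chart i q) = (q.1.1, (φ i q.1.1)⁻¹ * q.2) := by
    intro i q
    rw [E.symm_apply_eq]
    change _ = f _
    rw [hf i q.1.1 q.1.2, mul_inv_cancel_left]
  have cφ : ∀ i, Continuous fun q : P.U i × G => φ i q.1.1 :=
    fun i => (IsLocallyConstant.continuous (hφ.flat i)).comp continuous_fst
  refine ⟨⟨E, ?_, ?_⟩, hf⟩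
  · change Continuous f
    rw [continuous_iff_continuousAt]
    rintro ⟨x, g⟩
    have hemb : IsOpenEmbedding (Prod.map (Subtype.val : P.U (c x) → _) (id : G → G)) :=
      (P.isPEOpen_U (c x)).1.isOpenEmbedding_subtypeVal.prodMap .id
    rw [show (x, g) = Prod.map (Subtype.val : P.U (c x) → _) (id : G → G) (⟨x, hc x⟩, g) from rfl,
      ← hemb.continuousAt_iff]
    have : f ∘ Prod.map (Subtype.val : P.U (c x) → _) (id : G → G) =
        fun q => (P.chart (c x) (q.1, φ (c x) q.1.1 * q.2)).1 := by
      funext q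
      exact hf _ _ q.1.2 _
    rw [this]
    exact (continuous_subtype_val.comp ((P.chart (c x)).continuous.comp
      (continuous_fst.prodMk ((cφ (c x)).mul continuous_snd)))).continuousAt
  · change Continuous E.symm
    rw [continuous_iff_continuousAt]
    intro p
    let i := c (P.proj p)
    have hemb : IsOpenEmbedding ((↑) : P.proj ⁻¹' P.U i → P.Total) :=
      ((P.isPEOpen_U i).1.preimage P.continuous_proj).isOpenEmbedding_subtypeVal
    rw [show p = ((⟨p, hc _⟩ : P.proj ⁻¹' P.U i) : P.Total) from rfl, ← hemb.continuousAt_iff]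
    have : E.symm ∘ ((↑) : P.proj ⁻¹' P.U i → P.Total) =
        (fun q : P.U i × G => (q.1.1, (φ i q.1.1)⁻¹ * q.2)) ∘ (P.chart i).symm := by
      funext q
      rw [Function.comp_apply, Function.comp_apply, ← hE, Homeomorph.apply_symm_apply]
    rw [this]
    exact (((continuous_subtype_val.comp continuous_fst).prodMk
      ((cφ i).inv.mul continuous_snd)).comp (P.chart i).symm.continuous).continuousAt

/-- Both bundles are trivialized over `ℝ^d` by flat sections `φ` and `φ'`, and the isomorphism is
`φ' * φ⁻¹` in charts. The factors `u` and `u'` depend only on the point of `K_t`; the remaining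
factor is PE because the holonomies agree. -/
theorem IsHolonomy.isoAt [IsTopologicalGroup G] {t : ℝ} (hP : P.radius ≤ t) (hQ : Q.radius ≤ t)
    {ρ : approximantPi1 T x₀ t →* G} (hρP : P.IsHolonomy t ρ) (hρQ : Q.IsHolonomy t ρ) :
    P.IsoAt Q t := by
  obtain ⟨h, u, hu⟩ := P.exists_isFrame hP
  obtain ⟨h', u', hu'⟩ := Q.exists_isFrame hQ
  have heq := ((hu.isHolonomy hP).unique hP hρP).trans (hρQ.unique hQ (hu'.isHolonomy hQ))
  obtain ⟨φ, hφ, sec⟩ : ∃ φ, (φ = fun i x => u i (approximantProj T t x) *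
      h.along (approximantProjMap T t) x₀ x) ∧ P.IsFlatSection φ := ⟨_, rfl, hu.isFlatSection⟩
  obtain ⟨φ', hφ', sec'⟩ : ∃ φ, (φ = fun i x => u' i (approximantProj T t x) *
      h'.along (approximantProjMap T t) x₀ x) ∧ Q.IsFlatSection φ := ⟨_, rfl, hu'.isFlatSection⟩
  obtain ⟨e, he⟩ := sec.exists_homeomorph
  obtain ⟨e', he'⟩ := sec'.exists_homeomorph
  have hchart : ∀ i x (hi : x ∈ P.U i) g,
      e.symm (P.chart i (⟨x, hi⟩, g)) = (x, (φ i x)⁻¹ * g) := by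
    intro i x hi g
    rw [e.symm_apply_eq, he i x hi, mul_inv_cancel_left]
  have hchart' : ∀ i j x (hi : x ∈ P.U i) (hj : x ∈ Q.U j) (g : G),
      (e.symm.trans e') (P.chart i (⟨x, hi⟩, g)) =
        Q.chart j (⟨x, hj⟩, φ' j x * (φ i x)⁻¹ * g) := by
    intro i j x hi hj g
    rw [Homeomorph.trans_apply, hchart i x hi, he' j x hj, mul_assoc]
  refine ⟨e.symm.trans e', ?_, ?_, fun i j => ⟨fun x => φ' j x * (φ i x)⁻¹, ?_, ?_, hchart' i j⟩⟩
  · intro p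
    obtain ⟨⟨x, g⟩, rfl⟩ := e.surjective p
    obtain ⟨i, hi⟩ := P.cover_U x
    obtain ⟨j, hj⟩ := Q.cover_U x
    rw [Homeomorph.trans_apply, e.symm_apply_apply, he' j x hj, he i x hi, P.proj_chart,
      Q.proj_chart]
  · rw [← P.chart_base, hchart' _ Q.baseIndex x₀ P.base_mem Q.base_mem, ← Q.chart_base]
    simp [hφ, hφ', hu.base, hu'.base, PathRep.along_self]
  · intro x hx y hy hxy
    have hxy' := (approximantProj_eq_iff T).2 hxy
    have := PathRep.along_inv_mul_along_eq (approximantProjMap T t) (x₀ := x₀) (x := x) (y := y)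
      heq hxy'
    have h2 : h'.along (approximantProjMap T t) x₀ x * (h.along (approximantProjMap T t) x₀ x)⁻¹ =
        h'.along (approximantProjMap T t) x₀ y * (h.along (approximantProjMap T t) x₀ y)⁻¹ := by
      rw [mul_inv_eq_iff_eq_mul, mul_assoc, this, mul_inv_cancel_left]
    simp only [hφ, hφ', mul_inv_rev, hxy']
    rw [mul_assoc, ← mul_assoc (h'.along _ _ _), h2, mul_assoc, mul_assoc]
  · rw [isLocallyConstantOn_iff]
    intro x hx
    filter_upwards [nhdsWithin_mono x inter_subset_left (isLocallyConstantOn_iff.1 (sec.flat i) x hx.1),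
      nhdsWithin_mono x inter_subset_right (isLocallyConstantOn_iff.1 (sec'.flat j) x hx.2)] with y a b
    rw [a, b]

end FlatBasedPEBundle

/-! ### Local lifts of one approximant to `ℝ^d` over a finer one -/

/-- A compact set has a point furthest in the direction `v`, which the translation would push
further. -/
theorem Tile.eq_zero_of_translate_eq {d : ℕ} {L : Type v} {A : Tile d L}
    {v : EuclideanSpace ℝ (Fin d)} (h : A.translate v = A) : v = 0 := by
  obtain ⟨a, ha, hmax⟩ := A.isCompact.exists_isMaxOn A.nonempty
    (f := fun a => inner ℝ v a) (by fun_prop)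
  have hv : v + a ∈ A.carrier := by
    rw [← h]
    exact ⟨a, ha, rfl⟩
  have : inner ℝ v (v + a) ≤ inner ℝ v a := hmax hv
  rw [inner_add_right] at this
  exact inner_self_eq_zero.1 (le_antisymm (by linarith) (real_inner_self_nonneg (x := v)))

section

variable {d : ℕ} {L : Type v} (T : Tiling d L)

/-- Distinct places that look like `x` up to distance `R > 0` are a definite distance apart. -/
theorem exists_separation {R : ℝ} (hR : 0 < R) (x : EuclideanSpace ℝ (Fin d)) :
    ∃ ε > 0, ∀ z z', T.centeredPatch R z = T.centeredPatch R x →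
      T.centeredPatch R z' = T.centeredPatch R x → dist z z' < ε → z = z' := by
  obtain ⟨A, hA, hxA⟩ := T.cover x
  have hne : (interior A.carrier).Nonempty := by
    rw [← closure_nonempty_iff, A.closure_interior]
    exact A.nonempty
  obtain ⟨q, hq⟩ := hne
  obtain ⟨ε, hε, hball⟩ := Metric.isOpen_iff.1 isOpen_interior q hq
  have htile : ∀ z, T.centeredPatch R z = T.centeredPatch R x → A.translate (z - x) ∈ T.tiles := by
    intro z hz
    have : A.translate (-x) ∈ T.centeredPatch R z := by
      rw [hz]
      exact ⟨A, ⟨hA, x, hxA, Metric.mem_ball_self hR⟩, rfl⟩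
    obtain ⟨B, hB, e⟩ := this
    have e' := congrArg (Tile.translate z) e
    simp only [Tile.translate_translate] at e'
    rw [add_neg_cancel, Tile.translate_zero, ← sub_eq_add_neg] at e'
    rw [← e']
    exact hB.1
  refine ⟨ε, hε, fun z z' hz hz' hd => ?_⟩
  -- Both translates of the tile `A` at `x` belong to `T`. For a shift shorter than the radius of a
  -- ball in the interior of `A` their interiors meet, so they are the same tile.
  have heq : A.translate (z - x) = A.translate (z' - x) := by
    by_contra hne
    have hdisj := T.disjoint _ (htile z hz) _ (htile z' hz') hne
    simp only [Tile.translate, interior_vadd] at hdisj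
    refine disjoint_left.1 hdisj ⟨q, hq, rfl⟩ ?_
    · refine ⟨q + (z - z'), hball ?_, ?_⟩
      · rwa [mem_ball_iff_norm, add_sub_cancel_left, ← dist_eq_norm]
      · simp only [vadd_eq_add]
        abel
  have e' := congrArg (Tile.translate (-(z' - x))) heq
  simp only [Tile.translate_translate] at e'
  rw [neg_add_cancel, Tile.translate_zero] at e'
  have := Tile.eq_zero_of_translate_eq e'
  rw [← sub_eq_zero, ← this]
  abel

/-- On the PE open set `U` of radius `t`, the map `c` is a PE local translation which does not
change the centered patches of radius `s`. It induces a lift to `ℝ^d` of the forgetful map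
`K_t → K_s` on the image of `U`. -/
structure IsLocalLift (s t : ℝ) (U : Set (EuclideanSpace ℝ (Fin d)))
    (c : EuclideanSpace ℝ (Fin d) → EuclideanSpace ℝ (Fin d)) : Prop where
  isPEOpen : IsPEOpen T t U
  isPEOn : IsPEOn T t U c
  patch_eq : ∀ y ∈ U, T.centeredPatch s (c y) = T.centeredPatch s y
  translation : ∀ y ∈ U, ∀ᶠ y' in 𝓝 y, c y' = c y + (y' - y)

variable {T} in
theorem IsLocalLift.mono {s t : ℝ} {U V : Set (EuclideanSpace ℝ (Fin d))}
    {c : EuclideanSpace ℝ (Fin d) → EuclideanSpace ℝ (Fin d)} (h : IsLocalLift T s t V c)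
    (hUV : U ⊆ V) (hU : IsPEOpen T t U) : IsLocalLift T s t U c :=
  ⟨hU, fun x hx y hy => h.isPEOn x (hUV hx) y (hUV hy), fun y hy => h.patch_eq y (hUV hy),
    fun y hy => h.translation y (hUV hy)⟩

variable {T} in
theorem IsLocalLift.continuousOn {s t : ℝ} {U : Set (EuclideanSpace ℝ (Fin d))}
    {c : EuclideanSpace ℝ (Fin d) → EuclideanSpace ℝ (Fin d)} (h : IsLocalLift T s t U c) :
    ContinuousOn c U := by
  intro y hy
  apply ContinuousAt.continuousWithinAt
  have : ContinuousAt (fun y' => c y + (y' - y)) y := by fun_prop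
  exact this.congr ((h.translation y hy).mono fun _ e => e.symm)

/-- The points that are closer than `ε` to a place that looks like `x` up to distance `R`. -/
def nearCopies (R ε : ℝ) (x : EuclideanSpace ℝ (Fin d)) : Set (EuclideanSpace ℝ (Fin d)) :=
  {y | ∃ z, T.centeredPatch R z = T.centeredPatch R x ∧ dist y z < ε}

open Classical in
/-- The translation of a neighborhood of a place that looks like `x` to a neighborhood of `x`. -/
noncomputable def toOriginal (R ε : ℝ) (x y : EuclideanSpace ℝ (Fin d)) :
    EuclideanSpace ℝ (Fin d) :=
  if h : y ∈ nearCopies T R ε x then x + (y - h.choose) else y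

theorem mem_nearCopies_self {R ε : ℝ} (hε : 0 < ε) (x : EuclideanSpace ℝ (Fin d)) :
    x ∈ nearCopies T R ε x :=
  ⟨x, rfl, by simpa using hε⟩

/-- Two copies within `ε` of `y` are within `2 * ε` of each other, hence equal, so the chosen copy
may be replaced by any other. -/
theorem toOriginal_eq {R ε : ℝ} {x : EuclideanSpace ℝ (Fin d)}
    (hsep : ∀ z z', T.centeredPatch R z = T.centeredPatch R x →
      T.centeredPatch R z' = T.centeredPatch R x → dist z z' < 2 * ε → z = z')
    {y z : EuclideanSpace ℝ (Fin d)} (hz : T.centeredPatch R z = T.centeredPatch R x)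
    (hyz : dist y z < ε) : toOriginal T R ε x y = x + (y - z) := by
  have hy : y ∈ nearCopies T R ε x := ⟨z, hz, hyz⟩
  obtain ⟨h1, h2⟩ := hy.choose_spec
  rw [toOriginal, dif_pos hy, hsep _ z h1 hz]
  linarith [dist_triangle_left hy.choose z y]

/-- The patch of radius `R` at `z` is visible in the patch of radius `R + ε` at `y`, so it reappears
at the same relative position near `y'`. -/
theorem exists_copy_of_centeredPatch_eq {R ε t : ℝ} (hRt : R + ε ≤ t)
    {x y y' z : EuclideanSpace ℝ (Fin d)} (hz : T.centeredPatch R z = T.centeredPatch R x)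
    (hyz : dist y z < ε) (hy : T.centeredPatch t y = T.centeredPatch t y') :
    T.centeredPatch R (y' + (z - y)) = T.centeredPatch R x ∧ dist y' (y' + (z - y)) < ε := by
  rw [dist_comm, dist_eq_norm] at hyz
  constructor
  · rw [← Tiling.centeredPatch_add_eq hy (by linarith), add_sub_cancel, hz]
  · rwa [dist_self_add_right]

theorem isPEOpen_nearCopies {R ε t : ℝ} (hRt : R + ε ≤ t) (x : EuclideanSpace ℝ (Fin d)) :
    IsPEOpen T t (nearCopies T R ε x) := by
  constructor
  · rw [isOpen_iff_mem_nhds]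
    rintro y ⟨z, hz, hyz⟩
    filter_upwards [Metric.isOpen_ball.mem_nhds hyz] with y' hy'
    exact ⟨z, hz, hy'⟩
  · rintro y ⟨z, hz, hyz⟩ y' hy
    exact ⟨_, exists_copy_of_centeredPatch_eq T hRt hz hyz hy⟩

theorem isLocalLift_toOriginal {s R ε t : ℝ} (hsR : s + ε ≤ R) (hRt : R + ε ≤ t)
    {x : EuclideanSpace ℝ (Fin d)}
    (hsep : ∀ z z', T.centeredPatch R z = T.centeredPatch R x →
      T.centeredPatch R z' = T.centeredPatch R x → dist z z' < 2 * ε → z = z') :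
    IsLocalLift T s t (nearCopies T R ε x) (toOriginal T R ε x) := by
  refine ⟨isPEOpen_nearCopies T hRt x, ?_, ?_, ?_⟩
  · rintro y ⟨z, hz, hyz⟩ y' - hy
    obtain ⟨h1, h2⟩ := exists_copy_of_centeredPatch_eq T hRt hz hyz hy
    rw [toOriginal_eq T hsep hz hyz, toOriginal_eq T hsep h1 h2]
    abel
  · rintro y ⟨z, hz, hyz⟩
    rw [toOriginal_eq T hsep hz hyz]
    rw [dist_eq_norm] at hyz
    rw [← Tiling.centeredPatch_add_eq hz (by linarith), add_sub_cancel]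
  · rintro y ⟨z, hz, hyz⟩
    filter_upwards [Metric.isOpen_ball.mem_nhds hyz] with y' hy'
    rw [toOriginal_eq T hsep hz hyz, toOriginal_eq T hsep hz hy']
    abel

/-- There are local lifts around all points which agree with a given one near `x₀`. -/
theorem exists_localLifts (x₀ : EuclideanSpace ℝ (Fin d)) {s t : ℝ} (hst : max s 0 + 3 ≤ t) :
    ∃ B c₀, IsLocalLift T s t B c₀ ∧ x₀ ∈ B ∧ c₀ x₀ = x₀ ∧
      ∀ x, ∃ U c, IsLocalLift T s t U c ∧ x ∈ U ∧ ∀ y ∈ U ∩ B, c y = c₀ y := by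
  have h0 : 0 ≤ max s 0 := le_max_right _ _
  have hs : s ≤ max s 0 := le_max_left _ _
  have sep : ∀ R > 0, ∀ δ > 0, ∀ x, ∃ ε > 0, ε ≤ δ ∧ ∀ z z',
      T.centeredPatch R z = T.centeredPatch R x →
      T.centeredPatch R z' = T.centeredPatch R x → dist z z' < 2 * ε → z = z' := by
    intro R hR δ hδ x
    obtain ⟨ε, hε, h⟩ := exists_separation T hR x
    refine ⟨min (ε / 2) δ, lt_min (by positivity) hδ, min_le_right _ _,
      fun z z' hz hz' hd => h z z' hz hz' (hd.trans_le ?_)⟩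
    linarith [min_le_left (ε / 2) δ]
  -- Radii: `max s 0 + 1` suits the copies of `x₀`, as `ε ≤ 1`. Other points use `max s 0 + 2`, so
  -- that a copy of such a point still shows copies of `x₀` at distance less than `ε`. The third
  -- unit of `t` absorbs the last shift.
  obtain ⟨ε, hε, hε1, hsep⟩ := sep (max s 0 + 1) (by linarith) 1 one_pos x₀
  have lift := isLocalLift_toOriginal T (s := s) (t := t) (by linarith) (by linarith) hsep
  have hsub : nearCopies T (max s 0 + 1) (ε / 2) x₀ ⊆ nearCopies T (max s 0 + 1) ε x₀ :=
    fun y ⟨z, hz, hyz⟩ => ⟨z, hz, by linarith⟩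
  refine ⟨nearCopies T (max s 0 + 1) (ε / 2) x₀, toOriginal T (max s 0 + 1) ε x₀,
    lift.mono hsub (isPEOpen_nearCopies T (by linarith) x₀), mem_nearCopies_self T (by linarith) x₀,
    ?_, fun x => ?_⟩
  · rw [toOriginal_eq T hsep rfl (by simpa using hε)]
    simp
  -- The base set `B` has half the size of the domain of its lift. Points in the larger domain use
  -- the base lift itself; the charts around all other points are disjoint from `B`, so agreement on
  -- `B` is vacuous for them.
  by_cases hx : x ∈ nearCopies T (max s 0 + 1) ε x₀
  · exact ⟨_, _, lift, hx, fun _ _ => rfl⟩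
  obtain ⟨η, hη, hηε, hsep'⟩ := sep (max s 0 + 2) (by linarith) (ε / 2) (by linarith) x
  refine ⟨_, _, isLocalLift_toOriginal T (by linarith) (by linarith) hsep',
    mem_nearCopies_self T hη x, ?_⟩
  rintro y ⟨⟨z, hz, hyz⟩, w, hw, hyw⟩
  -- A common point `y` would place a copy `w` of `x₀` near a copy `z` of `x`, hence a copy of `x₀`
  -- within `ε` of `x`.
  refine absurd ⟨x + (w - z), ?_, ?_⟩ hx
  · have hwz : ‖w - z‖ < ε := by
      rw [← dist_eq_norm]
      linarith [dist_triangle_left w z y]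
    rw [← Tiling.centeredPatch_add_eq hz (by linarith), add_sub_cancel, hw]
  · rw [dist_self_add_right, ← dist_eq_norm]
    linarith [dist_triangle_left w z y]

end

/-! ### The bundle with a given holonomy -/

section

variable {d : ℕ} {L : Type v} {T : Tiling d L}

/-- Near `x` the map `c` is a translation preserving patches of radius `s`, so a short path and its
translate have the same image in `K_s`. -/
theorem IsLocalLift.eventually_along_eq {G : Type*} [Group G] {s t : ℝ}
    {U : Set (EuclideanSpace ℝ (Fin d))}
    {c : EuclideanSpace ℝ (Fin d) → EuclideanSpace ℝ (Fin d)} (hc : IsLocalLift T s t U c)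
    (h : PathRep (Approximant T s) G) {x : EuclideanSpace ℝ (Fin d)} (hx : x ∈ U) :
    ∀ᶠ y in 𝓝 x, h.along (approximantProjMap T s) (c x) (c y) =
      h.along (approximantProjMap T s) x y := by
  obtain ⟨δ, hδ, hball⟩ := Metric.mem_nhds_iff.1
    (inter_mem (hc.translation x hx) (hc.isPEOpen.1.mem_nhds hx))
  filter_upwards [Metric.ball_mem_nhds x hδ] with y hy
  obtain ⟨p, hp⟩ := ((convex_ball x δ).isPathConnected ⟨x, Metric.mem_ball_self hδ⟩).joinedIn x
    (Metric.mem_ball_self hδ) y hy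
  let q : Path (c x) (c y) :=
    { toFun := fun a => c x + (p a - x)
      source' := by simp
      target' := by
        rw [p.target]
        exact (hball hy).1.symm }
  rw [← h.hol_map _ p, ← h.hol_map _ q]
  refine h.hol_congr fun a => ?_
  change approximantProj T s (c x + (p a - x)) = approximantProj T s (p a)
  obtain ⟨h1, h2⟩ := hball (hp a)
  rw [approximantProj_eq_iff, ← hc.patch_eq _ h2, show c (p a) = _ from h1]

/-- The frame of the chart given by a local lift `c`, in the trivialisation over `ℝ^d` of the flat
bundle with parallel transport `h`. -/
noncomputable def PathRep.liftFrame {G : Type*} [Group G] {s : ℝ}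
    (h : PathRep (Approximant T s) G) (x₀ : EuclideanSpace ℝ (Fin d))
    (c : EuclideanSpace ℝ (Fin d) → EuclideanSpace ℝ (Fin d)) (x : EuclideanSpace ℝ (Fin d)) : G :=
  (h.along (approximantProjMap T s) x₀ x)⁻¹ * h.along (approximantProjMap T s) x₀ (c x)

theorem IsLocalLift.isLocallyConstantOn_liftFrame {G : Type*} [Group G] {s t : ℝ}
    {U : Set (EuclideanSpace ℝ (Fin d))}
    {c : EuclideanSpace ℝ (Fin d) → EuclideanSpace ℝ (Fin d)} (hc : IsLocalLift T s t U c)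
    (h : PathRep (Approximant T s) G) (x₀ : EuclideanSpace ℝ (Fin d)) :
    IsLocallyConstantOn U (h.liftFrame x₀ c) := by
  rw [FlatBasedPEBundle.isLocallyConstantOn_iff]
  intro x hx
  rw [hc.isPEOpen.1.nhdsWithin_eq hx]
  filter_upwards [hc.eventually_along_eq h hx] with y hy
  rw [PathRep.liftFrame, PathRep.liftFrame, ← h.along_trans _ x₀ x y,
    ← h.along_trans _ x₀ (c x) (c y), hy]
  group

/-- The homeomorphism of `U × G` with the part over `U` of `X × G` given by left multiplication with
a continuous function. -/
def mulLeftChart {X G : Type*} [TopologicalSpace X] [Group G] [TopologicalSpace G]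
    [IsTopologicalGroup G] {U : Set X} {φ : X → G} (hφ : Continuous (U.domRestrict φ)) :
    (U × G) ≃ₜ ((Prod.fst : X × G → X) ⁻¹' U) where
  toFun p := ⟨(p.1, φ p.1 * p.2), p.1.2⟩
  invFun q := (⟨q.1.1, q.2⟩, (φ q.1.1)⁻¹ * q.1.2)
  left_inv p := by simp
  right_inv q := by simp
  continuous_toFun := by
    have h1 : Continuous fun p : U × G => φ p.1 := hφ.comp continuous_fst
    exact ((continuous_subtype_val.comp continuous_fst).prodMk
      (h1.mul continuous_snd)).subtype_mk _
  continuous_invFun := by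
    have h0 : Continuous fun q : (Prod.fst : X × G → X) ⁻¹' U => (⟨q.1.1, q.2⟩ : U) :=
      (continuous_fst.comp continuous_subtype_val).subtype_mk _
    have h1 : Continuous fun q : (Prod.fst : X × G → X) ⁻¹' U => φ q.1.1 := hφ.comp h0
    exact h0.prodMk (h1.inv.mul (continuous_snd.comp continuous_subtype_val))

/-- The flat based PE bundle of radius `t` with parallel transport `h`, whose charts are all local
lifts which agree with `c₀` on `B`. -/
noncomputable def PathRep.bundle {G : Type u} [Group G] [TopologicalSpace G] [IsTopologicalGroup G]
    {s t : ℝ} (h : PathRep (Approximant T s) G) (ht : 0 < t) {x₀ : EuclideanSpace ℝ (Fin d)}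
    {B : Set (EuclideanSpace ℝ (Fin d))} {c₀ : EuclideanSpace ℝ (Fin d) → EuclideanSpace ℝ (Fin d)}
    (hB : IsLocalLift T s t B c₀) (hx₀ : x₀ ∈ B) (hc₀ : c₀ x₀ = x₀)
    (hcov : ∀ x, ∃ U c, IsLocalLift T s t U c ∧ x ∈ U ∧ ∀ y ∈ U ∩ B, c y = c₀ y) :
    FlatBasedPEBundle T G x₀ where
  radius := t
  radius_pos := ht
  Total := EuclideanSpace ℝ (Fin d) × G
  proj := Prod.fst
  continuous_proj := continuous_fst
  surjective_proj := Prod.fst_surjective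
  Index := ULift.{u} {p : Set (EuclideanSpace ℝ (Fin d)) ×
    (EuclideanSpace ℝ (Fin d) → EuclideanSpace ℝ (Fin d)) //
      IsLocalLift T s t p.1 p.2 ∧ ∀ y ∈ p.1 ∩ B, p.2 y = c₀ y}
  U i := i.down.1.1
  isPEOpen_U i := i.down.2.1.isPEOpen
  cover_U x := by
    obtain ⟨U, c, h1, h2, h3⟩ := hcov x
    exact ⟨⟨⟨(U, c), h1, h3⟩⟩, h2⟩
  chart i := mulLeftChart (i.down.2.1.isLocallyConstantOn_liftFrame h x₀).continuous
  proj_chart i p := rfl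
  -- The factor transporting from `x₀` to `x`, which need not be PE, cancels between the two frames.
  -- What remains depends on `x` only through the PE maps of the two local lifts.
  transition j i x := (h.along (approximantProjMap T s) x₀ (j.down.1.2 x))⁻¹ *
    h.along (approximantProjMap T s) x₀ (i.down.1.2 x)
  chart_eq i j x hi hj g := by
    refine Prod.ext rfl ?_
    change h.liftFrame x₀ _ x * g = h.liftFrame x₀ _ x * (_ * g)
    rw [PathRep.liftFrame, PathRep.liftFrame]
    group
  isPEOn_transition i j x hx y hy hxy := by
    beta_reduce
    rw [i.down.2.1.isPEOn x hx.2 y hy.2 hxy, j.down.2.1.isPEOn x hx.1 y hy.1 hxy]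
  flat i j := by
    have hi := i.down.2.1.isLocallyConstantOn_liftFrame h x₀
    have hj := j.down.2.1.isLocallyConstantOn_liftFrame h x₀
    rw [FlatBasedPEBundle.isLocallyConstantOn_iff] at hi hj ⊢
    intro x hx
    have key : ∀ y, (h.along (approximantProjMap T s) x₀ (j.down.1.2 y))⁻¹ *
        h.along (approximantProjMap T s) x₀ (i.down.1.2 y) =
        (h.liftFrame x₀ j.down.1.2 y)⁻¹ * h.liftFrame x₀ i.down.1.2 y := by
      intro y
      rw [PathRep.liftFrame, PathRep.liftFrame]
      group
    filter_upwards [nhdsWithin_mono x inter_subset_right (hi x hx.2),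
      nhdsWithin_mono x inter_subset_left (hj x hx.1)] with y a b
    rw [key, key, a, b]
  basePoint := (x₀, 1)
  baseIndex := ⟨⟨(B, c₀), hB, fun _ _ => rfl⟩⟩
  base_mem := hx₀
  chart_base := by
    refine Prod.ext rfl ?_
    change h.liftFrame x₀ c₀ x₀ * 1 = 1
    rw [PathRep.liftFrame, hc₀]
    group
  transition_base j x hx := by
    rw [j.down.2.2 x hx]
    group

/-- Over the domain of a chart, a path in `K_t` composed with the local lift is a path in `ℝ^d` with
the same image in `K_s`. Its transport therefore depends only on its endpoints. -/
theorem PathRep.isFrame_bundle {G : Type u} [Group G] [TopologicalSpace G] [IsTopologicalGroup G]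
    {s t : ℝ} (hst : s ≤ t) (h : PathRep (Approximant T s) G) (ht : 0 < t)
    {x₀ : EuclideanSpace ℝ (Fin d)} {B : Set (EuclideanSpace ℝ (Fin d))}
    {c₀ : EuclideanSpace ℝ (Fin d) → EuclideanSpace ℝ (Fin d)} (hB : IsLocalLift T s t B c₀)
    (hx₀ : x₀ ∈ B) (hc₀ : c₀ x₀ = x₀)
    (hcov : ∀ x, ∃ U c, IsLocalLift T s t U c ∧ x ∈ U ∧ ∀ y ∈ U ∩ B, c y = c₀ y) :
    (h.bundle ht hB hx₀ hc₀ hcov).IsFrame t (h.comap (forgetful T hst)) fun i z =>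
      (h.along (approximantProjMap T s) x₀ (i.down.1.2 (approximantLift T z)))⁻¹ := by
  refine ⟨fun i j x hi hj => ?_, fun i z w γ hγ => ?_, ?_⟩
  · have ei := i.down.2.1.isPEOn.apply_lift le_rfl i.down.2.1.isPEOpen hi
    have ej := j.down.2.1.isPEOn.apply_lift le_rfl j.down.2.1.isPEOpen hj
    simp only [ei, ej]
    change _ = (_ * _) * _
    group
  · have hi := i.down.2.1
    let p : Path (i.down.1.2 (approximantLift T z)) (i.down.1.2 (approximantLift T w)) :=
      { toFun := fun a => i.down.1.2 (approximantLift T (γ a))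
        continuous_toFun := (hi.isPEOn.continuousOn_comp_lift le_rfl hi.isPEOpen
          hi.continuousOn).comp_continuous γ.continuous hγ
        source' := by simp
        target' := by simp }
    have e : (h.comap (forgetful T hst)).hol γ =
        h.hol (p.map (approximantProjMap T s).continuous) := by
      refine h.hol_congr fun a => ?_
      change forgetful T hst (γ a) = approximantProj T s (i.down.1.2 (approximantLift T (γ a)))
      rw [(approximantProj_eq_iff T).2 (hi.patch_eq _ (lift_mem T le_rfl hi.isPEOpen (hγ a))),
        ← forgetful_proj T hst, approximantProj_lift]
    rw [e, h.hol_map, inv_inv, h.along_inv, h.along_trans]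
  · change (h.along (approximantProjMap T s) x₀ (c₀ _))⁻¹ = 1
    rw [hB.isPEOn.apply_lift le_rfl hB.isPEOpen hx₀, hc₀, h.along_self, inv_one]

/-- Every homomorphism `π₁(K_s) → G` becomes the holonomy of a flat PE bundle over `K_t` for large
`t`. -/
theorem exists_isHolonomy_forgetfulDual {G : Type u} [Group G] [TopologicalSpace G]
    [IsTopologicalGroup G] (x₀ : EuclideanSpace ℝ (Fin d)) {s t : ℝ} (hst : s ≤ t)
    (hst' : max s 0 + 3 ≤ t) (ρ : approximantPi1 T x₀ s →* G) :
    ∃ P : FlatBasedPEBundle T G x₀, P.radius = t ∧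
      P.IsHolonomy t (forgetfulDual T x₀ G hst ρ) := by
  obtain ⟨h, rfl⟩ := PathRep.exists_toHom_eq (approximantProj T s x₀) ρ
  obtain ⟨B, c₀, hB, hx₀, hc₀, hcov⟩ := exists_localLifts T x₀ hst'
  have ht : 0 < t := by linarith [le_max_right s 0]
  refine ⟨h.bundle ht hB hx₀ hc₀ hcov, rfl, ?_⟩
  have e : forgetfulDual T x₀ G hst (h.toHom _) = (h.comap (forgetful T hst)).toHom _ := by
    ext p
    rw [forgetfulDual, MonoidHom.comp_apply, forgetfulPi1, FundamentalGroup.mapOfEq_apply]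
    induction p using Quotient.inductionOn with
    | _ γ => rfl
  rw [e]
  exact (h.isFrame_bundle hst ht hB hx₀ hc₀ hcov).isHolonomy le_rfl

end

/-! ### The bijection with the direct limit. -/

theorem theorem1p2 {d : ℕ} {L : Type v} (T : Tiling d L) (x₀ : EuclideanSpace ℝ (Fin d))
    (G : Type u) [Group G] [TopologicalSpace G] [IsTopologicalGroup G]
    (t : ℕ → ℝ) (ht : Monotone t) (ht_top : Tendsto t atTop atTop) :
    ∃ e : PREPb T G x₀ ≃ HomLimit T x₀ G t ht,
      ∀ (n : ℕ) (P : FlatBasedPEBundle T G x₀), P.radius ≤ t n →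
        (∃! ρ : approximantPi1 T x₀ (t n) →* G, P.IsHolonomy (t n) ρ) ∧
        ∀ ρ : approximantPi1 T x₀ (t n) →* G, P.IsHolonomy (t n) ρ →
          e (PREPb.mk P) = HomLimit.of T x₀ G t ht n ρ := by
  have large : ∀ r : ℝ, ∃ n, r ≤ t n := fun r => (ht_top.eventually_ge_atTop r).exists
  have exist : ∀ (P : FlatBasedPEBundle T G x₀) (n : ℕ), P.radius ≤ t n →
      ∃ ρ : approximantPi1 T x₀ (t n) →* G, P.IsHolonomy (t n) ρ := by
    intro P n hn
    obtain ⟨h, u, hu⟩ := P.exists_isFrame hn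
    exact ⟨_, hu.isHolonomy hn⟩
  -- Pulled back to the level `max m n`, both homomorphisms are holonomies of `P`, so uniqueness
  -- identifies them.
  have limit_eq : ∀ (P : FlatBasedPEBundle T G x₀) (m n : ℕ) (ρ : approximantPi1 T x₀ (t m) →* G)
      (ρ' : approximantPi1 T x₀ (t n) →* G), P.radius ≤ t m → P.IsHolonomy (t m) ρ →
      P.IsHolonomy (t n) ρ' → HomLimit.of T x₀ G t ht m ρ = HomLimit.of T x₀ G t ht n ρ' := by
    intro P m n ρ ρ' hm hρ hρ'
    refine Quotient.sound (s := homLimitSetoid T x₀ G t ht)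
      ⟨max m n, le_max_left m n, le_max_right m n, ?_⟩
    exact (hρ.forget (ht (le_max_left m n))).unique (hm.trans (ht (le_max_left m n)))
      (hρ'.forget (ht (le_max_right m n)))
  choose N hN using fun P : FlatBasedPEBundle T G x₀ => large P.radius
  choose ρ hρ using fun P : FlatBasedPEBundle T G x₀ => exist P (N P) (hN P)
  let f : PREPb T G x₀ → HomLimit T x₀ G t ht :=
    Quotient.lift (fun P => HomLimit.of T x₀ G t ht (N P) (ρ P)) (by
      rintro P Q ⟨s, hP, hQ, hPQ⟩
      obtain ⟨k, hk⟩ := large s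
      obtain ⟨σ, hσ⟩ := exist P k (hP.trans hk)
      exact (limit_eq P _ k _ σ (hN P) (hρ P) hσ).trans
        (limit_eq Q _ k _ σ (hN Q) (hρ Q) (hσ.of_isoAt hP hQ hk hPQ)).symm)
  have hf : ∀ (n : ℕ) (P : FlatBasedPEBundle T G x₀) (σ : approximantPi1 T x₀ (t n) →* G),
      P.IsHolonomy (t n) σ → f (PREPb.mk P) = HomLimit.of T x₀ G t ht n σ :=
    fun n P σ hσ => limit_eq P _ n _ σ (hN P) (hρ P) hσ
  have inj : Function.Injective f := by
    intro p q
    induction p using Quotient.inductionOn with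
    | _ P =>
    induction q using Quotient.inductionOn with
    | _ Q =>
    intro e
    obtain ⟨k, hPk, hQk, e⟩ := Quotient.exact (s := homLimitSetoid T x₀ G t ht) e
    have hP := (hN P).trans (ht hPk)
    have hQ := (hN Q).trans (ht hQk)
    have hσQ := (hρ Q).forget (ht hQk)
    rw [← e] at hσQ
    exact Quotient.sound (s := flatBasedPEBundleSetoid T G x₀)
      ⟨t k, hP, hQ, ((hρ P).forget (ht hPk)).isoAt hP hQ hσQ⟩
  have surj : Function.Surjective f := by
    intro p
    induction p using Quotient.inductionOn with
    | _ p =>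
    obtain ⟨n, σ⟩ := p
    -- The level at which the local lifts exist; there the pullback of `σ`, which has the same class
    -- in the limit, is realized by a bundle.
    obtain ⟨m, hm⟩ := large (max (t n) 0 + 3)
    have hnk : t n ≤ t (max n m) := ht (le_max_left n m)
    obtain ⟨P, -, hP⟩ := exists_isHolonomy_forgetfulDual x₀ hnk
      (hm.trans (ht (le_max_right n m))) σ
    refine ⟨PREPb.mk P, (hf _ P _ hP).trans ?_⟩
    refine Quotient.sound (s := homLimitSetoid T x₀ G t ht)
      ⟨max n m, le_rfl, le_max_left n m, ?_⟩
    exact forgetfulDual_comp T x₀ G hnk le_rfl σ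
  refine ⟨Equiv.ofBijective f ⟨inj, surj⟩, fun n P hn => ⟨?_, hf n P⟩⟩
  obtain ⟨σ, hσ⟩ := exist P n hn
  exact ⟨σ, hσ, fun σ' hσ' => hσ'.unique hn hσ⟩
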